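/- Let $d\ge 1$ be an integer, let $p>1$ be real with $p(d-2)<d$, let $q$ be the conjugate exponent of $p$ ($\frac1p+\frac1q=1$), and let $a>0$. Let $(r_t)$ be real numbers, positive for all large $t$, with $r_t\to0$ as $t\to\infty$, and put $\alpha_t=r_t^{-q/d}$ and $\lambda_t=a\alpha_t^{-2}=a\,r_t^{2q/d}$. For a positive integer $L$ and an $L$-periodic function $f$ on $\mathbb Z^d$ (that is, $f(x+Le_i)=f(x)$ for all $x\in\mathbb Z^d$ and $1\le i\le d$) with values in $\mathbb R$ or $\mathbb R^d$, let $N_{s,L}(f)=\bigl(\sum_{x\in\{0,\dots,L-1\}^d}|f(x)|^s\bigr)^{1/s}$, where $|\cdot|$ is the Euclidean norm, and let $\tilde\nabla h(x)=(h(x+e_i)-h(x))_{1\le i\le d}$. For $R>0$ let $L_{R,t}$ be an integer side length of the discrete torus "of side $R\alpha_t$": any non-negative integer with $|L_{R,t}-R\alpha_t|\le 1$ for all $t$ large enough (depending on $R$; then $L_{R,t}\ge1$ for large $t$, since $\alpha_t\to\infty$), for instance $L_{R,t}=\lfloor R\alpha_t\rfloor$. Set $$\rho_1(a,R,t)=\inf\Bigl\{\lambda_t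 N_{2,L_{R,t}}^2(h)+\tfrac12 N_{2,L_{R,t}}^2(\tilde\nabla h)\;:\; h:\mathbb Z^d\to\mathbb R\ \ L_{R,t}\text{-periodic},\ N_{2p,L_{R,t}}(h)=1\Bigr\},$$ $$\rho(a)=\inf\Bigl\{a\|h\|_2^2+\tfrac12\|\nabla h\|_2^2\;:\; h\in L^{2p}(\mathbb R^d),\ \|h\|_{2p}=1\Bigr\},$$ where $h$ is real-valued, $\nabla h$ is the weak gradient, and the functional is $+\infty$ unless $h$ and $\nabla h$ are square integrable. Then $$\liminf_{R\to\infty}\ \liminf_{t\to\infty}\ r_t^{\,1-2q/d}\,\rho_1(a,R,t)\ \ge\ \rho(a).$$ -/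

import Mathlib

open MeasureTheory Filter Topology
open scoped ENNReal ContDiff

noncomputable section

/-- A function on `ℤ^d` is `L`-periodic if it is invariant under translation by `L` in every
coordinate direction; such functions are the functions on the discrete torus of side `L`. -/
def IsPeriodic {d : ℕ} (L : ℕ) (h : (Fin d → ℤ) → ℝ) : Prop :=
  ∀ (x : Fin d → ℤ) (i : Fin d), h (x + Pi.single i (L : ℤ)) = h x

/-- The discrete gradient, `(∇̃ h)_i (x) = h (x + e_i) - h x`. -/
def discreteGradient {d : ℕ} (h : (Fin d → ℤ) → ℝ) (x : Fin d → ℤ) : EuclideanSpace ℝ (Fin d) :=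
  WithLp.toLp 2 (fun i => h (x + Pi.single i 1) - h x)

/-- The `ℓ^s`-norm `N_{s,L}(f)` over one period cell `{0, …, L-1}^d` of an `L`-periodic function
`f` on `ℤ^d`, with values in a normed space. -/
def periodNorm {d : ℕ} {E : Type*} [NormedAddCommGroup E] (s : ℝ) (L : ℕ)
    (f : (Fin d → ℤ) → E) : ℝ :=
  (∑ x : Fin d → Fin L, ‖f (fun i => ((x i : ℕ) : ℤ))‖ ^ s) ^ (1 / s)

/-- The discrete variational formula: the infimum of
`lam * N_{2,L}(h)^2 + 1/2 * N_{2,L}(∇̃ h)^2` over the `L`-periodic `h : ℤ^d → ℝ` with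
`N_{2p,L}(h) = 1`. -/
def rhoDiscrete (d : ℕ) (p lam : ℝ) (L : ℕ) : ℝ≥0∞ :=
  ⨅ (h : (Fin d → ℤ) → ℝ) (_ : IsPeriodic L h) (_ : periodNorm (2 * p) L h = 1),
    ENNReal.ofReal
      (lam * periodNorm 2 L h ^ 2 + 1 / 2 * periodNorm 2 L (discreteGradient h) ^ 2)

/-- `G` is the weak (distributional) gradient of `h` on `ℝ^d`, both being locally integrable. -/
structure HasWeakGradient {d : ℕ} (h : EuclideanSpace ℝ (Fin d) → ℝ)
    (G : EuclideanSpace ℝ (Fin d) → EuclideanSpace ℝ (Fin d)) : Prop where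
  locallyIntegrable : LocallyIntegrable h volume
  locallyIntegrable_grad : LocallyIntegrable G volume
  integral_eq : ∀ φ : EuclideanSpace ℝ (Fin d) → ℝ, ContDiff ℝ ∞ φ → HasCompactSupport φ →
    ∀ v : EuclideanSpace ℝ (Fin d),
      ∫ x, h x * fderiv ℝ φ x v = - ∫ x, inner ℝ (G x) v * φ x

/-- The continuous variational formula: the infimum of `a * ‖h‖_2^2 + 1/2 * ‖∇h‖_2^2` over
`h ∈ L^{2p}(ℝ^d)` with `‖h‖_{2p} = 1`. The value of the functional is `∞` when `h` or its gradient
is not square integrable, in particular when `h` has no locally integrable weak gradient. -/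
def rhoContinuous (d : ℕ) (p a : ℝ) : ℝ≥0∞ :=
  ⨅ (h : EuclideanSpace ℝ (Fin d) → ℝ) (G : EuclideanSpace ℝ (Fin d) → EuclideanSpace ℝ (Fin d))
    (_ : MemLp h (ENNReal.ofReal (2 * p)) volume)
    (_ : eLpNorm h (ENNReal.ofReal (2 * p)) volume = 1)
    (_ : HasWeakGradient h G),
    ENNReal.ofReal a * eLpNorm h 2 volume ^ 2 + ENNReal.ofReal (1 / 2) * eLpNorm G 2 volume ^ 2

end

/-! Every admissible periodic lattice function can be turned into a test function for
`rhoContinuous` with explicit, vanishing losses. No compactness or extraction of limits is needed.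

Two operations do this. The first is a cutoff (`IsPeriodic.exists_cutoff`). By averaging over
translations, some translate of `h` keeps at least its proportional share of the `2p`-mass on an
inner cube. Multiplying by a product cutoff of slope `1 / w` then gives a finitely supported
function whose energy grows by at most the factor `cutoffLoss`. The second is multilinear
interpolation on the lattice of spacing `α⁻¹`. It does not increase the rescaled `L²`-norm, and each
partial derivative is itself an interpolation of a forward difference
(`hasWeakGradient_latticeInterp_hat`), so the Dirichlet energy does not increase either.

The normalisation could be lost in the second operation. Piecewise constant interpolation preserves
the rescaled `2p`-norm exactly. The tent kernel is the box kernel plus a difference of ramps, and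
summation by parts moves this difference onto the lattice function. The loss is therefore at most
the sum of the `2p`-norms of the forward differences (`eLpNorm_box_le_hat_add`), which `ℓ² ⊆ ℓ^{2p}`
bounds by `d` times the discrete Dirichlet norm. If the rescaled energy stays below `M`, the
unscaled energy is at most `M * α ^ (d / q - 2)`. This tends to zero because `p (d - 2) < d` means
`d / q < 2`.

With `R = K ^ 2` the boundary layer has macroscopic width `K`: long enough for a small slope, yet a
fraction of order `1 / K` of the torus. Letting `t → ∞` and then `K → ∞` removes all losses. -/

noncomputable section

variable {d : ℕ}

/-! ### One-dimensional kernels -/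

/-- The indicator function of `[0, 1)`. -/
def boxKernel : ℝ → ℝ := (Set.Ico (0 : ℝ) 1).indicator 1

/-- The function `u ↦ u` restricted to `[0, 1)`. -/
def rampKernel : ℝ → ℝ := (Set.Ico (0 : ℝ) 1).indicator id

/-- The tent function of width one. -/
def hatKernel (u : ℝ) : ℝ := max 0 (1 - |u|)

/-- Nonnegative integrable kernels whose integer translates have total mass at most one, both
pointwise and in the mean. -/
structure IsSubKernel (k : ℝ → ℝ) : Prop where
  nonneg : ∀ u, 0 ≤ k u
  measurable : Measurable k
  integrable : Integrable k volume
  integral_le : ∫ u, k u ≤ 1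
  sum_le : ∀ (F : Finset ℤ) (u : ℝ), ∑ m ∈ F, k (u - m) ≤ 1

lemma sum_le_sum_of_support_subset {ι : Type*} {f : ι → ℝ} (hf : ∀ x, 0 ≤ f x)
    (F P : Finset ι) (h : ∀ x, f x ≠ 0 → x ∈ P) : ∑ x ∈ F, f x ≤ ∑ x ∈ P, f x := by
  classical
  calc ∑ x ∈ F, f x ≤ ∑ x ∈ F ∪ P, f x :=
        Finset.sum_le_sum_of_subset_of_nonneg Finset.subset_union_left fun x _ _ => hf x
    _ = ∑ x ∈ P, f x := by
        symm
        apply Finset.sum_subset Finset.subset_union_right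
        intro x _ hx
        by_contra hne
        exact hx (h x hne)

lemma boxKernel_of_mem {u : ℝ} (h : u ∈ Set.Ico (0 : ℝ) 1) : boxKernel u = 1 := by
  simp [boxKernel, Set.indicator_of_mem h]

lemma boxKernel_of_notMem {u : ℝ} (h : u ∉ Set.Ico (0 : ℝ) 1) : boxKernel u = 0 := by
  simp [boxKernel, Set.indicator_of_notMem h]

lemma rampKernel_of_mem {u : ℝ} (h : u ∈ Set.Ico (0 : ℝ) 1) : rampKernel u = u := by
  simp [rampKernel, Set.indicator_of_mem h]

lemma rampKernel_of_notMem {u : ℝ} (h : u ∉ Set.Ico (0 : ℝ) 1) : rampKernel u = 0 := by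
  simp [rampKernel, Set.indicator_of_notMem h]

lemma boxKernel_sub_int_ne_zero {u : ℝ} {m : ℤ} (h : boxKernel (u - m) ≠ 0) : m = ⌊u⌋ := by
  by_contra hm
  apply h
  apply boxKernel_of_notMem
  rintro ⟨h1, h2⟩
  exact hm ((Int.floor_eq_iff.2 ⟨by linarith, by linarith⟩).symm)

lemma boxKernel_sub_floor (u : ℝ) : boxKernel (u - ⌊u⌋) = 1 :=
  boxKernel_of_mem ⟨by linarith [Int.floor_le u], by linarith [Int.lt_floor_add_one u]⟩

lemma boxKernel_nonneg (u : ℝ) : 0 ≤ boxKernel u := by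
  by_cases h : u ∈ Set.Ico (0 : ℝ) 1
  · simp [boxKernel_of_mem h]
  · simp [boxKernel_of_notMem h]

lemma rampKernel_nonneg (u : ℝ) : 0 ≤ rampKernel u := by
  by_cases h : u ∈ Set.Ico (0 : ℝ) 1
  · simpa [rampKernel_of_mem h] using h.1
  · simp [rampKernel_of_notMem h]

lemma rampKernel_le_boxKernel (u : ℝ) : rampKernel u ≤ boxKernel u := by
  by_cases h : u ∈ Set.Ico (0 : ℝ) 1
  · simpa [rampKernel_of_mem h, boxKernel_of_mem h] using h.2.le
  · simp [rampKernel_of_notMem h, boxKernel_of_notMem h]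

lemma integrable_boxKernel : Integrable boxKernel volume := by
  refine (integrable_indicator_iff measurableSet_Ico).2 ?_
  exact integrableOn_const (by simp)

lemma integral_boxKernel : ∫ u, boxKernel u = 1 := by
  simp [boxKernel, integral_indicator measurableSet_Ico]

lemma isSubKernel_boxKernel : IsSubKernel boxKernel where
  nonneg := boxKernel_nonneg
  measurable := measurable_one.indicator measurableSet_Ico
  integrable := integrable_boxKernel
  integral_le := integral_boxKernel.le
  sum_le F u := by
    refine (sum_le_sum_of_support_subset (fun m => boxKernel_nonneg _) F {⌊u⌋} ?_).trans ?_
    · intro m hm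
      simpa using boxKernel_sub_int_ne_zero hm
    · simp only [Finset.sum_singleton]
      exact (boxKernel_sub_floor u).le

lemma isSubKernel_rampKernel : IsSubKernel rampKernel where
  nonneg := rampKernel_nonneg
  measurable := measurable_id.indicator measurableSet_Ico
  integrable := by
    refine integrable_boxKernel.mono'
      (measurable_id.indicator measurableSet_Ico).aestronglyMeasurable (ae_of_all _ fun u => ?_)
    rw [Real.norm_of_nonneg (rampKernel_nonneg u)]
    exact rampKernel_le_boxKernel u
  integral_le := by
    rw [← integral_boxKernel]
    exact integral_mono_of_nonneg (ae_of_all _ rampKernel_nonneg) integrable_boxKernel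
      (ae_of_all _ rampKernel_le_boxKernel)
  sum_le F u := (Finset.sum_le_sum fun m _ => rampKernel_le_boxKernel _).trans
    (isSubKernel_boxKernel.sum_le F u)

/-- This splitting is what makes box and tent interpolation comparable: the correction is a unit
difference of a bounded kernel, so it can be summed by parts on the lattice. -/
lemma hatKernel_eq (u : ℝ) : hatKernel u = boxKernel u + (rampKernel (u + 1) - rampKernel u) := by
  by_cases h : u ∈ Set.Ico (0 : ℝ) 1
  · have h1 : u + 1 ∉ Set.Ico (0 : ℝ) 1 := fun h' => by linarith [h'.2, h.1]
    rw [boxKernel_of_mem h, rampKernel_of_mem h, rampKernel_of_notMem h1, hatKernel,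
      abs_of_nonneg h.1, max_eq_right (by linarith [h.2])]
    ring
  · rw [boxKernel_of_notMem h, rampKernel_of_notMem h]
    by_cases h1 : u + 1 ∈ Set.Ico (0 : ℝ) 1
    · rw [rampKernel_of_mem h1, hatKernel, abs_of_nonpos (by linarith [h1.2]),
        max_eq_right (by linarith [h1.1])]
      ring
    · rw [rampKernel_of_notMem h1, hatKernel, max_eq_left]
      · ring
      · simp only [Set.mem_Ico, not_and_or, not_le, not_lt] at h h1
        have : 1 ≤ |u| := by
          rw [le_abs]
          rcases h with h | h
          · rcases h1 with h1 | h1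
            · right; linarith
            · linarith
          · exact Or.inl h
        linarith

lemma hatKernel_nonneg (u : ℝ) : 0 ≤ hatKernel u := le_max_left _ _

lemma hatKernel_le_one (u : ℝ) : hatKernel u ≤ 1 :=
  max_le zero_le_one (by linarith [abs_nonneg u])

lemma lipschitzWith_hatKernel : LipschitzWith 1 hatKernel := by
  refine LipschitzWith.of_dist_le_mul fun x y => ?_
  rw [NNReal.coe_one, one_mul, Real.dist_eq, Real.dist_eq, hatKernel, hatKernel]
  refine (abs_max_sub_max_le_max _ _ _ _).trans ?_
  simp only [sub_self, abs_zero, sub_sub_sub_cancel_left]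
  refine max_le (abs_nonneg _) ?_
  rw [abs_sub_comm x y]
  exact abs_abs_sub_abs_le_abs_sub _ _

lemma isSubKernel_hatKernel : IsSubKernel hatKernel where
  nonneg := hatKernel_nonneg
  measurable := lipschitzWith_hatKernel.continuous.measurable
  integrable := by
    have : hatKernel = fun u => boxKernel u + (rampKernel (u + 1) - rampKernel u) :=
      funext hatKernel_eq
    rw [this]
    exact integrable_boxKernel.add
      ((isSubKernel_rampKernel.integrable.comp_add_right 1).sub isSubKernel_rampKernel.integrable)
  integral_le := by
    simp_rw [hatKernel_eq]
    have h1 := isSubKernel_rampKernel.integrable.comp_add_right 1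
    have h2 : ∫ u, (rampKernel (u + 1) - rampKernel u) = 0 := by
      rw [integral_sub h1 isSubKernel_rampKernel.integrable,
        integral_add_right_eq_self rampKernel, sub_self]
    have h3 := integral_add integrable_boxKernel (h1.sub isSubKernel_rampKernel.integrable)
    simp only [Pi.sub_apply] at h3
    rw [h3, h2, add_zero, integral_boxKernel]
  sum_le F u := by
    -- At most two translates of the tent are nonzero at `u`, and their values are one minus the
    -- fractional part of `u` and that fractional part.
    refine (sum_le_sum_of_support_subset (fun m => hatKernel_nonneg _) F {⌊u⌋, ⌊u⌋ + 1} ?_).trans ?_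
    · intro m hm
      have h1 : |u - m| < 1 := by
        by_contra h
        exact hm (max_eq_left (by linarith))
      rw [abs_lt] at h1
      have h2 : ⌊u⌋ < m + 1 := by
        rw [Int.floor_lt]; push_cast; linarith
      have h3 : m - 1 ≤ ⌊u⌋ := by
        rw [Int.le_floor]; push_cast; linarith
      simp only [Finset.mem_insert, Finset.mem_singleton]
      omega
    · rw [Finset.sum_pair (by omega)]
      have h1 := Int.floor_le u
      have h2 := Int.lt_floor_add_one u
      simp only [hatKernel]
      push_cast
      rw [abs_of_nonneg (by linarith), abs_of_nonpos (by linarith), max_eq_right (by linarith),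
        max_eq_right (by linarith)]
      linarith

/-- Off the integers `-1, 0, 1` the tent function is differentiable. -/
lemma hasDerivAt_hatKernel {u : ℝ} (h0 : u ≠ 0) (h1 : u ≠ 1) (h2 : u ≠ -1) :
    HasDerivAt hatKernel (boxKernel (u + 1) - boxKernel u) u := by
  have key : ∀ (c e : ℝ), hatKernel =ᶠ[𝓝 u] (fun v => c * v + e) →
      c = boxKernel (u + 1) - boxKernel u →
      HasDerivAt hatKernel (boxKernel (u + 1) - boxKernel u) u := by
    intro c e h hc
    rw [← hc]
    refine HasDerivAt.congr_of_eventuallyEq ?_ h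
    simpa using ((hasDerivAt_id u).const_mul c).add_const e
  rcases lt_trichotomy u 0 with hu | hu | hu
  · rcases lt_or_gt_of_ne h2 with hu' | hu'
    · refine key 0 0 ?_ ?_
      · filter_upwards [Iio_mem_nhds hu'] with v hv
        simp only [Set.mem_Iio] at hv
        rw [hatKernel, abs_of_neg (by linarith), max_eq_left (by linarith)]
        ring
      · rw [boxKernel_of_notMem, boxKernel_of_notMem, sub_self]
        · exact fun h => by linarith [h.1]
        · exact fun h => by linarith [h.1]
    · refine key 1 1 ?_ ?_
      · filter_upwards [Ioo_mem_nhds hu' hu] with v hv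
        rw [hatKernel, abs_of_neg hv.2, max_eq_right (by linarith [hv.1])]
        ring
      · rw [boxKernel_of_mem, boxKernel_of_notMem, sub_zero]
        · exact fun h => by linarith [h.1]
        · exact ⟨by linarith, by linarith⟩
  · exact absurd hu h0
  · rcases lt_or_gt_of_ne h1 with hu' | hu'
    · refine key (-1) 1 ?_ ?_
      · filter_upwards [Ioo_mem_nhds hu hu'] with v hv
        rw [hatKernel, abs_of_pos hv.1, max_eq_right (by linarith [hv.2])]
        ring
      · rw [boxKernel_of_notMem, boxKernel_of_mem, zero_sub]
        · exact ⟨by linarith, by linarith⟩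
        · exact fun h => by linarith [h.2]
    · refine key 0 0 ?_ ?_
      · filter_upwards [Ioi_mem_nhds hu'] with v hv
        simp only [Set.mem_Ioi] at hv
        rw [hatKernel, abs_of_pos (by linarith), max_eq_left (by linarith)]
        ring
      · rw [boxKernel_of_notMem, boxKernel_of_notMem, sub_self]
        · exact fun h => by linarith [h.2]
        · exact fun h => by linarith [h.2]

/-! ### Tensor products of kernels and interpolation -/

/-- The tensor product kernel of lattice spacing `α⁻¹` attached to the lattice point `x`. -/
def latticeWeight (α : ℝ) (k : Fin d → ℝ → ℝ) (x : Fin d → ℤ) (y : EuclideanSpace ℝ (Fin d)) : ℝ :=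
  ∏ i, k i (α * y i - x i)

/-- Interpolation of a lattice function by a tensor product kernel. -/
def latticeInterp (α : ℝ) (k : Fin d → ℝ → ℝ) (h : (Fin d → ℤ) → ℝ)
    (y : EuclideanSpace ℝ (Fin d)) : ℝ :=
  ∑' x, h x * latticeWeight α k x y

/-- The forward difference in the `i`-th coordinate direction. -/
def forwardDiff (i : Fin d) (h : (Fin d → ℤ) → ℝ) (x : Fin d → ℤ) : ℝ :=
  h (x + Pi.single i 1) - h x

lemma latticeWeight_nonneg {k : Fin d → ℝ → ℝ} (hk : ∀ i, IsSubKernel (k i)) (α : ℝ)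
    (x : Fin d → ℤ) (y : EuclideanSpace ℝ (Fin d)) : 0 ≤ latticeWeight α k x y :=
  Finset.prod_nonneg fun i _ => (hk i).nonneg _

lemma measurable_latticeWeight {k : Fin d → ℝ → ℝ} (hk : ∀ i, IsSubKernel (k i)) (α : ℝ)
    (x : Fin d → ℤ) : Measurable (latticeWeight α k x) := by
  refine Finset.measurable_prod _ fun i _ => (hk i).measurable.comp ?_
  fun_prop

lemma sum_latticeWeight_le {k : Fin d → ℝ → ℝ} (hk : ∀ i, IsSubKernel (k i)) (α : ℝ)
    (S : Finset (Fin d → ℤ)) (y : EuclideanSpace ℝ (Fin d)) :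
    ∑ x ∈ S, latticeWeight α k x y ≤ 1 := by
  classical
  -- Enlarging `S` to the product of its coordinate projections makes the sum of products factor
  -- into one-dimensional sums.
  let F : Fin d → Finset ℤ := fun i => S.image fun x => x i
  calc ∑ x ∈ S, latticeWeight α k x y
      ≤ ∑ x ∈ Fintype.piFinset F, latticeWeight α k x y := by
        refine Finset.sum_le_sum_of_subset_of_nonneg (fun x hx => ?_)
          fun x _ _ => latticeWeight_nonneg hk α x y
        rw [Fintype.mem_piFinset]
        exact fun i => Finset.mem_image_of_mem _ hx
    _ = ∏ i, ∑ m ∈ F i, k i (α * y i - m) := by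
        rw [Finset.prod_univ_sum]
        rfl
    _ ≤ 1 := Finset.prod_le_one (fun i _ => Finset.sum_nonneg fun m _ => (hk i).nonneg _)
        fun i _ => (hk i).sum_le _ _

lemma lintegral_latticeWeight {k : Fin d → ℝ → ℝ} (hk : ∀ i, IsSubKernel (k i)) {α : ℝ}
    (hα : 0 < α) (x : Fin d → ℤ) :
    ∫⁻ y, ENNReal.ofReal (latticeWeight α k x y) =
      ENNReal.ofReal ((α⁻¹) ^ d * ∏ i, ∫ u, k i u) := by
  have hint : ∀ i, Integrable (fun u => k i (α * u - x i)) volume := fun i =>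
    ((hk i).integrable.comp_sub_right ((x i : ℤ) : ℝ)).comp_mul_left' hα.ne'
  have h1 : ∫⁻ y, ENNReal.ofReal (latticeWeight α k x y) =
      ∫⁻ z : Fin d → ℝ, ENNReal.ofReal (∏ i, k i (α * z i - x i)) :=
    (PiLp.volume_preserving_ofLp (Fin d)).lintegral_comp
      (f := fun z : Fin d → ℝ => ENNReal.ofReal (∏ i, k i (α * z i - x i)))
      (Finset.measurable_prod _ fun i _ => (hk i).measurable.comp (by fun_prop)).ennreal_ofReal
  rw [h1, ← ofReal_integral_eq_lintegral_ofReal]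
  · congr 1
    rw [integral_fintype_prod_volume_eq_prod (fun i u => k i (α * u - x i))]
    have : ∀ i, ∫ u, k i (α * u - x i) = α⁻¹ * ∫ u, k i u := by
      intro i
      rw [Measure.integral_comp_mul_left (fun v => k i (v - x i)),
        integral_sub_right_eq_self (k i), abs_of_pos (inv_pos.2 hα), smul_eq_mul]
    simp_rw [this]
    rw [Finset.prod_mul_distrib]
    simp
  · exact Integrable.fintype_prod hint
  · exact ae_of_all _ fun z => Finset.prod_nonneg fun i _ => (hk i).nonneg _

lemma lintegral_latticeWeight_le {k : Fin d → ℝ → ℝ} (hk : ∀ i, IsSubKernel (k i)) {α : ℝ}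
    (hα : 0 < α) (x : Fin d → ℤ) :
    ∫⁻ y, ENNReal.ofReal (latticeWeight α k x y) ≤ ENNReal.ofReal ((α⁻¹) ^ d) := by
  rw [lintegral_latticeWeight hk hα]
  refine ENNReal.ofReal_le_ofReal (mul_le_of_le_one_right (by positivity) ?_)
  exact Finset.prod_le_one (fun i _ => integral_nonneg (hk i).nonneg) fun i _ => (hk i).integral_le

lemma latticeInterp_eq_sum {h : (Fin d → ℤ) → ℝ} (S : Finset (Fin d → ℤ))
    (hS : ∀ x, h x ≠ 0 → x ∈ S) (α : ℝ) (k : Fin d → ℝ → ℝ) (y : EuclideanSpace ℝ (Fin d)) :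
    latticeInterp α k h y = ∑ x ∈ S, h x * latticeWeight α k x y := by
  refine tsum_eq_sum fun x hx => ?_
  have : h x = 0 := by
    by_contra h0
    exact hx (hS x h0)
  rw [this, zero_mul]

lemma measurable_latticeInterp {h : (Fin d → ℤ) → ℝ} (hh : h.support.Finite)
    {k : Fin d → ℝ → ℝ} (hk : ∀ i, IsSubKernel (k i)) (α : ℝ) :
    Measurable (latticeInterp α k h) := by
  have : latticeInterp α k h = fun y => ∑ x ∈ hh.toFinset, h x * latticeWeight α k x y :=
    funext fun y => latticeInterp_eq_sum _ (by simp) α k y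
  rw [this]
  exact Finset.measurable_sum _ fun x _ => (measurable_latticeWeight hk α x).const_mul _

/-- Interpolation is a contraction from `ℓ^s` to `L^s`, up to the volume of the lattice cells. -/
lemma lintegral_latticeInterp_le {h : (Fin d → ℤ) → ℝ} (hh : h.support.Finite)
    {k : Fin d → ℝ → ℝ} (hk : ∀ i, IsSubKernel (k i)) {α : ℝ} (hα : 0 < α) {s : ℝ} (hs : 1 ≤ s) :
    ∫⁻ y, ‖latticeInterp α k h y‖ₑ ^ s ≤ ENNReal.ofReal ((α⁻¹) ^ d) * ∑' x, ‖h x‖ₑ ^ s := by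
  have hs0 : 0 < s := by linarith
  have hpt : ∀ y, ‖latticeInterp α k h y‖ₑ ^ s ≤
      ∑' x, ENNReal.ofReal (latticeWeight α k x y) * ‖h x‖ₑ ^ s := by
    intro y
    rw [latticeInterp_eq_sum hh.toFinset (by simp) α k y]
    refine le_trans ?_ (ENNReal.sum_le_tsum hh.toFinset)
    have h1 : ‖∑ x ∈ hh.toFinset, h x * latticeWeight α k x y‖ₑ ≤
        ∑ x ∈ hh.toFinset, ENNReal.ofReal (latticeWeight α k x y) * ‖h x‖ₑ := by
      refine (enorm_sum_le _ _).trans (Finset.sum_le_sum fun x _ => ?_)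
      rw [enorm_mul, mul_comm, Real.enorm_of_nonneg (latticeWeight_nonneg hk α x y)]
    -- Weighted Hölder, that is, Jensen for a sub-probability: the total weight is at most one and
    -- appears with the nonnegative exponent `1 - s⁻¹`, so it can be dropped.
    have h2 := ENNReal.inner_le_weight_mul_Lp_of_nonneg hh.toFinset hs
      (fun x => ENNReal.ofReal (latticeWeight α k x y)) (fun x => ‖h x‖ₑ)
    have h3 : (∑ x ∈ hh.toFinset, ENNReal.ofReal (latticeWeight α k x y)) ^ (1 - s⁻¹) ≤ 1 := by
      refine ENNReal.rpow_le_one ?_ (by rw [sub_nonneg]; exact inv_le_one_of_one_le₀ hs)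
      rw [← ENNReal.ofReal_sum_of_nonneg fun x _ => latticeWeight_nonneg hk α x y]
      exact ENNReal.ofReal_le_one.2 (sum_latticeWeight_le hk α _ y)
    have h4 := h1.trans (h2.trans (mul_le_of_le_one_left' h3))
    calc _ ≤ _ := ENNReal.rpow_le_rpow h4 hs0.le
      _ = _ := by rw [← ENNReal.rpow_mul, inv_mul_cancel₀ hs0.ne', ENNReal.rpow_one]
  calc ∫⁻ y, ‖latticeInterp α k h y‖ₑ ^ s
      ≤ ∫⁻ y, ∑' x, ENNReal.ofReal (latticeWeight α k x y) * ‖h x‖ₑ ^ s := lintegral_mono hpt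
    _ = ∑' x, ∫⁻ y, ENNReal.ofReal (latticeWeight α k x y) * ‖h x‖ₑ ^ s :=
        lintegral_tsum fun x =>
          ((measurable_latticeWeight hk α x).ennreal_ofReal.mul_const _).aemeasurable
    _ ≤ ∑' x, ENNReal.ofReal ((α⁻¹) ^ d) * ‖h x‖ₑ ^ s := by
        refine ENNReal.tsum_le_tsum fun x => ?_
        rw [lintegral_mul_const _ (measurable_latticeWeight hk α x).ennreal_ofReal]
        gcongr
        exact lintegral_latticeWeight_le hk hα x
    _ = _ := ENNReal.tsum_mul_left

lemma latticeWeight_box_ne_zero {α : ℝ} {x : Fin d → ℤ} {y : EuclideanSpace ℝ (Fin d)}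
    (h : latticeWeight α (fun _ => boxKernel) x y ≠ 0) : x = fun i => ⌊α * y i⌋ := by
  rw [latticeWeight, Finset.prod_ne_zero_iff] at h
  exact funext fun i => boxKernel_sub_int_ne_zero (h i (Finset.mem_univ i))

lemma latticeWeight_box_floor (α : ℝ) (y : EuclideanSpace ℝ (Fin d)) :
    latticeWeight α (fun _ => boxKernel) (fun i => ⌊α * y i⌋) y = 1 :=
  Finset.prod_eq_one fun _ _ => boxKernel_sub_floor _

/-- Piecewise constant interpolation preserves the `s`-th moments up to the volume of the cells. -/
lemma lintegral_latticeInterp_box (h : (Fin d → ℤ) → ℝ) {α : ℝ} (hα : 0 < α) (s : ℝ) :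
    ∫⁻ y, ‖latticeInterp α (fun _ => boxKernel) h y‖ₑ ^ s =
      ENNReal.ofReal ((α⁻¹) ^ d) * ∑' x, ‖h x‖ₑ ^ s := by
  have hk : ∀ _ : Fin d, IsSubKernel boxKernel := fun _ => isSubKernel_boxKernel
  have hpt : ∀ y, ‖latticeInterp α (fun _ => boxKernel) h y‖ₑ ^ s =
      ∑' x, ENNReal.ofReal (latticeWeight α (fun _ => boxKernel) x y) * ‖h x‖ₑ ^ s := by
    intro y
    rw [latticeInterp, tsum_eq_single (fun i => ⌊α * y i⌋), tsum_eq_single (fun i => ⌊α * y i⌋),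
      latticeWeight_box_floor]
    · simp
    · intro x hx
      have : latticeWeight α (fun _ => boxKernel) x y = 0 := by
        by_contra h0
        exact hx (latticeWeight_box_ne_zero h0)
      simp [this]
    · intro x hx
      have : latticeWeight α (fun _ => boxKernel) x y = 0 := by
        by_contra h0
        exact hx (latticeWeight_box_ne_zero h0)
      simp [this]
  simp_rw [hpt]
  rw [lintegral_tsum fun x =>
    ((measurable_latticeWeight hk α x).ennreal_ofReal.mul_const _).aemeasurable,
    ← ENNReal.tsum_mul_left]
  refine tsum_congr fun x => ?_
  rw [lintegral_mul_const _ (measurable_latticeWeight hk α x).ennreal_ofReal,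
    lintegral_latticeWeight hk hα]
  simp [integral_boxKernel]

lemma latticeWeight_update (α : ℝ) (k : Fin d → ℝ → ℝ) (i : Fin d) (f : ℝ → ℝ) (x : Fin d → ℤ)
    (y : EuclideanSpace ℝ (Fin d)) :
    latticeWeight α (Function.update k i f) x y =
      f (α * y i - x i) * ∏ j ∈ Finset.univ.erase i, k j (α * y j - x j) := by
  rw [latticeWeight, ← Finset.mul_prod_erase _ _ (Finset.mem_univ i), Function.update_self]
  congr 1
  refine Finset.prod_congr rfl fun j hj => ?_
  rw [Function.update_of_ne (Finset.ne_of_mem_erase hj)]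

lemma finite_support_shift {h : (Fin d → ℤ) → ℝ} (hh : h.support.Finite) (v : Fin d → ℤ) :
    (Function.support fun x => h (x + v)).Finite :=
  hh.preimage (f := fun x => x + v) (add_left_injective v).injOn

lemma finite_support_forwardDiff {h : (Fin d → ℤ) → ℝ} (hh : h.support.Finite) (i : Fin d) :
    (forwardDiff i h).support.Finite :=
  ((finite_support_shift hh _).union hh).subset (Function.support_sub _ _)

/-- Summation by parts: a difference of kernels moves onto the lattice function. -/
lemma latticeInterp_update_sub {h : (Fin d → ℤ) → ℝ} (hh : h.support.Finite) (α : ℝ)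
    (k : Fin d → ℝ → ℝ) (i : Fin d) (κ : ℝ → ℝ) (y : EuclideanSpace ℝ (Fin d)) :
    latticeInterp α (Function.update k i fun u => κ (u + 1) - κ u) h y =
      latticeInterp α (Function.update k i κ) (forwardDiff i h) y := by
  let e : Fin d → ℤ := Pi.single i 1
  let Q : (Fin d → ℤ) → ℝ := fun x => ∏ j ∈ Finset.univ.erase i, k j (α * y j - x j)
  have hQ : ∀ x, Q (x + e) = Q x := by
    intro x
    refine Finset.prod_congr rfl fun j hj => ?_
    simp [e, Pi.single_eq_of_ne (Finset.ne_of_mem_erase hj)]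
  have s1 : Summable fun x => h x * (κ (α * y i - x i + 1) * Q x) :=
    summable_of_hasFiniteSupport (hh.subset (Function.support_mul_subset_left _ _))
  have s2 : Summable fun x => h x * (κ (α * y i - x i) * Q x) :=
    summable_of_hasFiniteSupport (hh.subset (Function.support_mul_subset_left _ _))
  have s3 : Summable fun x => h (x + e) * (κ (α * y i - x i) * Q x) :=
    summable_of_hasFiniteSupport
      ((finite_support_shift hh e).subset (Function.support_mul_subset_left _ _))
  have h1 : ∑' x, h x * (κ (α * y i - x i + 1) * Q x) =
      ∑' x, h (x + e) * (κ (α * y i - x i) * Q x) := by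
    rw [← Equiv.tsum_eq (Equiv.addRight e)]
    refine tsum_congr fun x => ?_
    simp only [Equiv.coe_addRight, hQ]
    congr 3
    simp only [e, Pi.add_apply, Pi.single_eq_same]
    push_cast
    ring
  calc _ = ∑' x, (h x * (κ (α * y i - x i + 1) * Q x) - h x * (κ (α * y i - x i) * Q x)) := by
        refine tsum_congr fun x => ?_
        rw [latticeWeight_update]
        simp only [Q]
        ring
    _ = ∑' x, (h (x + e) * (κ (α * y i - x i) * Q x) - h x * (κ (α * y i - x i) * Q x)) := by
        rw [s1.tsum_sub s2, s3.tsum_sub s2, h1]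
    _ = _ := by
        refine tsum_congr fun x => ?_
        rw [latticeWeight_update, forwardDiff]
        simp only [Q, e]
        ring

/-! ### Comparison of box and tent interpolation -/

/-- Piecewise constant interpolation has the largest `L^s`-norm among all interpolations. -/
lemma eLpNorm_latticeInterp_le_box {h : (Fin d → ℤ) → ℝ} (hh : h.support.Finite)
    {k : Fin d → ℝ → ℝ} (hk : ∀ i, IsSubKernel (k i)) {α : ℝ} (hα : 0 < α) {s : ℝ} (hs : 1 ≤ s) :
    eLpNorm (latticeInterp α k h) (ENNReal.ofReal s) volume ≤
      eLpNorm (latticeInterp α (fun _ => boxKernel) h) (ENNReal.ofReal s) volume := by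
  have hs0 : 0 < s := by linarith
  have h0 : ENNReal.ofReal s ≠ 0 := by simpa using hs0
  rw [eLpNorm_eq_lintegral_rpow_enorm_toReal h0 ENNReal.ofReal_ne_top,
    eLpNorm_eq_lintegral_rpow_enorm_toReal h0 ENNReal.ofReal_ne_top, ENNReal.toReal_ofReal hs0.le,
    lintegral_latticeInterp_box h hα]
  exact ENNReal.rpow_le_rpow (lintegral_latticeInterp_le hh hk hα hs) (by positivity)

lemma eLpNorm_latticeInterp_box (h : (Fin d → ℤ) → ℝ) {α : ℝ} (hα : 0 < α) {s : ℝ} (hs : 0 < s) :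
    eLpNorm (latticeInterp α (fun _ => boxKernel) h) (ENNReal.ofReal s) volume =
      (ENNReal.ofReal ((α⁻¹) ^ d) * ∑' x, ‖h x‖ₑ ^ s) ^ (1 / s) := by
  have h0 : ENNReal.ofReal s ≠ 0 := by simpa using hs
  rw [eLpNorm_eq_lintegral_rpow_enorm_toReal h0 ENNReal.ofReal_ne_top,
    ENNReal.toReal_ofReal hs.le, lintegral_latticeInterp_box h hα]

lemma latticeInterp_update_add {h : (Fin d → ℤ) → ℝ} (hh : h.support.Finite) (α : ℝ)
    (k : Fin d → ℝ → ℝ) (i : Fin d) (f g : ℝ → ℝ) (y : EuclideanSpace ℝ (Fin d)) :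
    latticeInterp α (Function.update k i fun u => f u + g u) h y =
      latticeInterp α (Function.update k i f) h y + latticeInterp α (Function.update k i g) h y := by
  simp only [latticeInterp_eq_sum hh.toFinset (h := h) (by simp), ← Finset.sum_add_distrib,
    latticeWeight_update]
  exact Finset.sum_congr rfl fun x _ => by ring

lemma isSubKernel_update {k : Fin d → ℝ → ℝ} (hk : ∀ i, IsSubKernel (k i)) (i : Fin d)
    {f : ℝ → ℝ} (hf : IsSubKernel f) (j : Fin d) : IsSubKernel (Function.update k i f j) := by
  rcases eq_or_ne j i with rfl | hj
  · simpa using hf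
  · simpa [Function.update_of_ne hj] using hk j

/-- Replacing the box kernel by the tent kernel in one direction changes the interpolation by at
most a forward difference. -/
lemma latticeInterp_update_hat {h : (Fin d → ℤ) → ℝ} (hh : h.support.Finite) (α : ℝ)
    (k : Fin d → ℝ → ℝ) (i : Fin d) :
    latticeInterp α (Function.update k i hatKernel) h =
      latticeInterp α (Function.update k i boxKernel) h +
        latticeInterp α (Function.update k i rampKernel) (forwardDiff i h) := by
  funext y
  have : hatKernel = fun u => boxKernel u + (rampKernel (u + 1) - rampKernel u) :=
    funext hatKernel_eq
  rw [this, latticeInterp_update_add hh α k i boxKernel fun u => rampKernel (u + 1) - rampKernel u,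
    latticeInterp_update_sub hh, Pi.add_apply]

/-- Passing from piecewise constant to multilinear interpolation loses at most the `L^s`-norms of
the forward differences. -/
lemma eLpNorm_box_le_hat_add {h : (Fin d → ℤ) → ℝ} (hh : h.support.Finite) {α : ℝ} (hα : 0 < α)
    {s : ℝ} (hs : 1 ≤ s) :
    eLpNorm (latticeInterp α (fun _ => boxKernel) h) (ENNReal.ofReal s) volume ≤
      eLpNorm (latticeInterp α (fun _ => hatKernel) h) (ENNReal.ofReal s) volume +
        ∑ i, eLpNorm (latticeInterp α (fun _ => boxKernel) (forwardDiff i h))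
          (ENNReal.ofReal s) volume := by
  classical
  -- Tent kernels in the directions of `S` and box kernels elsewhere: the induction on `S` exchanges
  -- one direction at a time, each at the price of one forward difference.
  let k : Finset (Fin d) → Fin d → ℝ → ℝ := fun S =>
    S.piecewise (fun _ => hatKernel) fun _ => boxKernel
  have hk : ∀ S i, IsSubKernel (k S i) := by
    intro S i
    by_cases hi : i ∈ S
    · simpa [k, Finset.piecewise_eq_of_mem _ _ _ hi] using isSubKernel_hatKernel
    · simpa [k, Finset.piecewise_eq_of_notMem _ _ _ hi] using isSubKernel_boxKernel
  have key : ∀ S : Finset (Fin d),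
      eLpNorm (latticeInterp α (fun _ => boxKernel) h) (ENNReal.ofReal s) volume ≤
        eLpNorm (latticeInterp α (k S) h) (ENNReal.ofReal s) volume +
          ∑ i ∈ S, eLpNorm (latticeInterp α (fun _ => boxKernel) (forwardDiff i h))
            (ENNReal.ofReal s) volume := by
    intro S
    induction S using Finset.induction_on with
    | empty => simp [k]
    | insert i S hi ih =>
      refine ih.trans ?_
      rw [Finset.sum_insert hi, ← add_assoc]
      gcongr
      have h1 : k (insert i S) = Function.update (k S) i hatKernel := Finset.piecewise_insert _ _ _ _
      have h2 : Function.update (k S) i boxKernel = k S := by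
        rw [Function.update_eq_self_iff]
        simp [k, Finset.piecewise_eq_of_notMem _ _ _ hi]
      have hD := finite_support_forwardDiff hh i
      have hr := isSubKernel_update (hk S) i isSubKernel_rampKernel
      have h3 : latticeInterp α (k S) h = latticeInterp α (k (insert i S)) h -
          latticeInterp α (Function.update (k S) i rampKernel) (forwardDiff i h) := by
        rw [h1, latticeInterp_update_hat hh, h2, add_sub_cancel_right]
      rw [h3]
      refine (eLpNorm_sub_le (measurable_latticeInterp hh (hk _) α).aestronglyMeasurable
        (measurable_latticeInterp hD hr α).aestronglyMeasurable (by simpa using hs)).trans ?_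
      gcongr
      exact eLpNorm_latticeInterp_le_box hD hr hα hs
  have := key Finset.univ
  simpa [k] using this

/-! ### The multilinear interpolation and its weak gradient -/

/-- Telescoping over the factors. It serves twice: for the Lipschitz bound on tensor products of
tents and for the slope of the product cutoff. -/
lemma abs_prod_sub_prod_le {ι : Type*} (S : Finset ι) (a b : ι → ℝ) (ha : ∀ i, |a i| ≤ 1)
    (hb : ∀ i, |b i| ≤ 1) : |∏ i ∈ S, a i - ∏ i ∈ S, b i| ≤ ∑ i ∈ S, |a i - b i| := by
  classical
  induction S using Finset.induction_on with
  | empty => simp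
  | insert i S hi ih =>
    rw [Finset.prod_insert hi, Finset.prod_insert hi, Finset.sum_insert hi]
    have h1 : |∏ j ∈ S, a j| ≤ 1 := by
      rw [Finset.abs_prod]
      exact Finset.prod_le_one (fun _ _ => abs_nonneg _) fun j _ => ha j
    calc |a i * ∏ j ∈ S, a j - b i * ∏ j ∈ S, b j|
        = |(a i - b i) * ∏ j ∈ S, a j + b i * (∏ j ∈ S, a j - ∏ j ∈ S, b j)| := by ring_nf
      _ ≤ |a i - b i| * |∏ j ∈ S, a j| + |b i| * |∏ j ∈ S, a j - ∏ j ∈ S, b j| := by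
          rw [← abs_mul, ← abs_mul]
          exact abs_add_le _ _
      _ ≤ |a i - b i| * 1 + 1 * ∑ j ∈ S, |a j - b j| := by
          gcongr
          exact hb i
      _ = _ := by ring

/-- Lipschitz continuity makes integration by parts against test functions available, with the
almost everywhere line derivative as the weak one. -/
lemma exists_lipschitzWith_latticeInterp_hat {h : (Fin d → ℤ) → ℝ} (hh : h.support.Finite) {α : ℝ}
    (hα : 0 < α) : ∃ C, LipschitzWith C (latticeInterp α (fun _ => hatKernel) h) := by
  have hw : ∀ (x : Fin d → ℤ) (y z : EuclideanSpace ℝ (Fin d)),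
      |latticeWeight α (fun _ => hatKernel) x y - latticeWeight α (fun _ => hatKernel) x z| ≤
        d * (α * dist y z) := by
    intro x y z
    have hb : ∀ u, |hatKernel u| ≤ 1 := fun u => by
      rw [abs_of_nonneg (hatKernel_nonneg u)]
      exact hatKernel_le_one u
    refine (abs_prod_sub_prod_le _ _ _ (fun i => hb _) fun i => hb _).trans ?_
    calc _ ≤ ∑ _i : Fin d, α * dist y z := by
          refine Finset.sum_le_sum fun i _ => ?_
          have h1 := lipschitzWith_hatKernel.dist_le_mul (α * y i - x i) (α * z i - x i)
          rw [Real.dist_eq, Real.dist_eq, NNReal.coe_one, one_mul] at h1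
          refine h1.trans ?_
          have h2 : α * y i - x i - (α * z i - x i) = α * (y i - z i) := by ring
          rw [h2, abs_mul, abs_of_pos hα]
          gcongr
          rw [dist_eq_norm]
          exact PiLp.norm_apply_le (y - z) i
      _ = _ := by simp
  refine ⟨Real.toNNReal (∑ x ∈ hh.toFinset, |h x| * (d * α)), LipschitzWith.of_dist_le_mul ?_⟩
  intro y z
  rw [Real.coe_toNNReal _ (Finset.sum_nonneg fun x _ => by positivity), Real.dist_eq,
    latticeInterp_eq_sum hh.toFinset (by simp), latticeInterp_eq_sum hh.toFinset (by simp),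
    ← Finset.sum_sub_distrib, Finset.sum_mul]
  refine (Finset.abs_sum_le_sum_abs _ _).trans (Finset.sum_le_sum fun x _ => ?_)
  rw [← mul_sub, abs_mul, mul_assoc, mul_assoc]
  gcongr
  exact hw x y z

/-- The `i`-th component of the gradient of the multilinear interpolation. -/
def interpPartial (α : ℝ) (h : (Fin d → ℤ) → ℝ) (i : Fin d) (y : EuclideanSpace ℝ (Fin d)) : ℝ :=
  α * latticeInterp α (Function.update (fun _ => hatKernel) i boxKernel) (forwardDiff i h) y

/-- The gradient of the multilinear interpolation. -/
def interpGradient (α : ℝ) (h : (Fin d → ℤ) → ℝ) (y : EuclideanSpace ℝ (Fin d)) :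
    EuclideanSpace ℝ (Fin d) :=
  WithLp.toLp 2 fun i => interpPartial α h i y

lemma isSubKernel_update_hat_box (i j : Fin d) :
    IsSubKernel (Function.update (fun _ => hatKernel) i boxKernel j) :=
  isSubKernel_update (fun _ => isSubKernel_hatKernel) i isSubKernel_boxKernel j

lemma measurable_interpPartial {h : (Fin d → ℤ) → ℝ} (hh : h.support.Finite) (α : ℝ) (i : Fin d) :
    Measurable (interpPartial α h i) :=
  (measurable_latticeInterp (finite_support_forwardDiff hh i)
    (isSubKernel_update_hat_box i) α).const_mul α

lemma measurable_interpGradient {h : (Fin d → ℤ) → ℝ} (hh : h.support.Finite) (α : ℝ) :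
    Measurable (interpGradient α h) :=
  (WithLp.measurable_toLp 2 (Fin d → ℝ)).comp
    (measurable_pi_lambda _ fun i => measurable_interpPartial hh α i)

lemma lintegral_interpPartial_sq_le {h : (Fin d → ℤ) → ℝ} (hh : h.support.Finite) {α : ℝ}
    (hα : 0 < α) (i : Fin d) :
    ∫⁻ y, ‖interpPartial α h i y‖ₑ ^ (2 : ℝ) ≤
      ENNReal.ofReal (α ^ 2 * (α⁻¹) ^ d) * ∑' x, ‖forwardDiff i h x‖ₑ ^ (2 : ℝ) := by
  have hD := finite_support_forwardDiff hh i
  have h1 := lintegral_latticeInterp_le hD (isSubKernel_update_hat_box i) hα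
    (s := 2) (by norm_num)
  have hm := (measurable_latticeInterp hD (isSubKernel_update_hat_box i) α).enorm.pow_const (2 : ℝ)
  have h2 : ENNReal.ofReal (α ^ 2) = ‖α‖ₑ ^ (2 : ℝ) := by
    rw [Real.enorm_of_nonneg hα.le, ENNReal.ofReal_rpow_of_pos hα]
    norm_num
  calc ∫⁻ y, ‖interpPartial α h i y‖ₑ ^ (2 : ℝ)
      = ‖α‖ₑ ^ (2 : ℝ) * ∫⁻ y, ‖latticeInterp α (Function.update (fun _ => hatKernel) i boxKernel)
          (forwardDiff i h) y‖ₑ ^ (2 : ℝ) := by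
        rw [← lintegral_const_mul _ hm]
        refine lintegral_congr fun y => ?_
        rw [interpPartial, enorm_mul, ENNReal.mul_rpow_of_nonneg _ _ (by norm_num)]
    _ ≤ _ := by
        rw [ENNReal.ofReal_mul (by positivity), h2, mul_assoc]
        gcongr

lemma tsum_enorm_rpow_ne_top {h : (Fin d → ℤ) → ℝ} (hh : h.support.Finite) {s : ℝ} (hs : 0 < s) :
    ∑' x, ‖h x‖ₑ ^ s ≠ ⊤ := by
  rw [tsum_eq_sum (s := hh.toFinset)]
  · exact ENNReal.sum_ne_top.2 fun x _ => ENNReal.rpow_ne_top_of_nonneg hs.le enorm_ne_top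
  · intro x hx
    have : h x = 0 := by simpa using hx
    simp [this, hs]

lemma memLp_latticeInterp {h : (Fin d → ℤ) → ℝ} (hh : h.support.Finite) {k : Fin d → ℝ → ℝ}
    (hk : ∀ i, IsSubKernel (k i)) {α : ℝ} (hα : 0 < α) {s : ℝ} (hs : 1 ≤ s) :
    MemLp (latticeInterp α k h) (ENNReal.ofReal s) volume := by
  refine ⟨(measurable_latticeInterp hh hk α).aestronglyMeasurable,
    (eLpNorm_latticeInterp_le_box hh hk hα hs).trans_lt ?_⟩
  rw [eLpNorm_latticeInterp_box h hα (by linarith)]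
  exact (ENNReal.rpow_ne_top_of_nonneg (by positivity) (ENNReal.mul_ne_top ENNReal.ofReal_ne_top
    (tsum_enorm_rpow_ne_top hh (by linarith)))).lt_top

lemma eLpNorm_two_sq {E : Type*} [NormedAddCommGroup E] (f : EuclideanSpace ℝ (Fin d) → E) :
    eLpNorm f 2 volume ^ 2 = ∫⁻ y, ‖f y‖ₑ ^ (2 : ℝ) := by
  rw [eLpNorm_eq_lintegral_rpow_enorm_toReal (by norm_num) (by norm_num), ← ENNReal.rpow_natCast,
    ← ENNReal.rpow_mul]
  norm_num

lemma eLpNorm_latticeInterp_two_sq_le {h : (Fin d → ℤ) → ℝ} (hh : h.support.Finite)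
    {k : Fin d → ℝ → ℝ} (hk : ∀ i, IsSubKernel (k i)) {α : ℝ} (hα : 0 < α) :
    eLpNorm (latticeInterp α k h) 2 volume ^ 2 ≤
      ENNReal.ofReal ((α⁻¹) ^ d) * ∑' x, ‖h x‖ₑ ^ (2 : ℝ) := by
  rw [eLpNorm_two_sq]
  exact lintegral_latticeInterp_le hh hk hα (by norm_num)

lemma EuclideanSpace.enorm_rpow_two (v : EuclideanSpace ℝ (Fin d)) :
    ‖v‖ₑ ^ (2 : ℝ) = ∑ i, ‖v i‖ₑ ^ (2 : ℝ) := by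
  have h := EuclideanSpace.norm_sq_eq v
  have h2 := congrArg ENNReal.ofReal h
  rw [ENNReal.ofReal_sum_of_nonneg fun i _ => by positivity] at h2
  have h3 : ∀ t : ℝ, 0 ≤ t → ENNReal.ofReal (t ^ 2) = ENNReal.ofReal t ^ (2 : ℝ) := fun t ht => by
    rw [ENNReal.ofReal_pow ht, ← ENNReal.rpow_natCast]
    norm_num
  rw [h3 _ (norm_nonneg _), ofReal_norm] at h2
  rw [h2]
  exact Finset.sum_congr rfl fun i _ => by rw [h3 _ (norm_nonneg _), ofReal_norm]

lemma eLpNorm_interpGradient_two_sq_le {h : (Fin d → ℤ) → ℝ} (hh : h.support.Finite) {α : ℝ}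
    (hα : 0 < α) :
    eLpNorm (interpGradient α h) 2 volume ^ 2 ≤
      ENNReal.ofReal (α ^ 2 * (α⁻¹) ^ d) * ∑ i, ∑' x, ‖forwardDiff i h x‖ₑ ^ (2 : ℝ) := by
  rw [eLpNorm_two_sq]
  simp_rw [EuclideanSpace.enorm_rpow_two, interpGradient]
  rw [lintegral_finsetSum _ fun i _ => (measurable_interpPartial hh α i).enorm.pow_const _,
    Finset.mul_sum]
  exact Finset.sum_le_sum fun i _ => lintegral_interpPartial_sq_le hh hα i

lemma memLp_interpGradient {h : (Fin d → ℤ) → ℝ} (hh : h.support.Finite) {α : ℝ} (hα : 0 < α) :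
    MemLp (interpGradient α h) 2 volume := by
  refine ⟨(measurable_interpGradient hh α).aestronglyMeasurable, ?_⟩
  have h1 := (eLpNorm_interpGradient_two_sq_le hh hα).trans_lt (ENNReal.mul_lt_top
    ENNReal.ofReal_lt_top (ENNReal.sum_lt_top.2 fun i _ =>
      (tsum_enorm_rpow_ne_top (finite_support_forwardDiff hh i) (s := 2) (by norm_num)).lt_top))
  by_contra h2
  rw [not_lt, top_le_iff] at h2
  rw [h2] at h1
  simp at h1

/-- The multilinear interpolation is differentiable in the `i`-th direction off the grid. -/
lemma hasLineDerivAt_latticeInterp_hat {h : (Fin d → ℤ) → ℝ} (hh : h.support.Finite) (α : ℝ)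
    (i : Fin d) (y : EuclideanSpace ℝ (Fin d)) (hy : ∀ m : ℤ, α * y i ≠ m) :
    HasLineDerivAt ℝ (latticeInterp α (fun _ => hatKernel) h) (interpPartial α h i y) y
      (EuclideanSpace.single i 1) := by
  let Q : (Fin d → ℤ) → ℝ := fun x => ∏ j ∈ Finset.univ.erase i, hatKernel (α * y j - x j)
  have h1 : ∀ t : ℝ, latticeInterp α (fun _ => hatKernel) h (y + t • EuclideanSpace.single i 1) =
      ∑ x ∈ hh.toFinset, h x * (hatKernel (α * (y i + t) - x i) * Q x) := by
    intro t
    rw [latticeInterp_eq_sum hh.toFinset (by simp)]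
    refine Finset.sum_congr rfl fun x _ => ?_
    -- The constant family is read as its own trivial update at `i`, which isolates the only factor
    -- that depends on `t`.
    have h2 := latticeWeight_update α (fun _ : Fin d => hatKernel) i hatKernel x
      (y + t • EuclideanSpace.single i 1)
    rw [Function.update_eq_self_iff.2 rfl] at h2
    rw [h2]
    congr 2
    · simp
    · refine Finset.prod_congr rfl fun j hj => ?_
      simp [Finset.ne_of_mem_erase hj]
  have h3 : interpPartial α h i y = ∑ x ∈ hh.toFinset, h x *
      ((boxKernel (α * y i - x i + 1) - boxKernel (α * y i - x i)) * α * Q x) := by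
    rw [interpPartial, ← latticeInterp_update_sub hh, latticeInterp_eq_sum hh.toFinset (by simp),
      Finset.mul_sum]
    refine Finset.sum_congr rfl fun x _ => ?_
    rw [latticeWeight_update]
    simp only [Q]
    ring
  rw [HasLineDerivAt, h3]
  simp_rw [h1]
  refine HasDerivAt.fun_sum fun x _ => ?_
  refine HasDerivAt.const_mul _ (HasDerivAt.mul_const ?_ _)
  have hne : ∀ m : ℤ, α * y i - x i ≠ m := by
    intro m hm
    apply hy (m + x i)
    push_cast
    linarith
  have h4 := hasDerivAt_hatKernel (by simpa using hne 0) (by simpa using hne 1)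
    (by simpa using hne (-1))
  have h5 : HasDerivAt (fun t : ℝ => α * (y i + t) - x i) α 0 := by
    simpa using (((hasDerivAt_id (0 : ℝ)).const_add (y i)).const_mul α).sub_const ((x i : ℤ) : ℝ)
  have h6 : HasDerivAt hatKernel (boxKernel (α * y i - x i + 1) - boxKernel (α * y i - x i))
      (α * (y i + 0) - x i) := by simpa using h4
  exact HasDerivAt.comp (h₂ := hatKernel) (0 : ℝ) h6 h5

lemma ae_lineDeriv_latticeInterp_hat {h : (Fin d → ℤ) → ℝ} (hh : h.support.Finite) {α : ℝ}
    (hα : 0 < α) (i : Fin d) :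
    ∀ᵐ y : EuclideanSpace ℝ (Fin d), lineDeriv ℝ (latticeInterp α (fun _ => hatKernel) h) y
      (EuclideanSpace.single i 1) = interpPartial α h i y := by
  have h1 : ∀ᵐ z : Fin d → ℝ, ∀ m : ℤ, z i ≠ m / α :=
    -- The grid is a countable union of null hyperplanes.
    ae_all_iff.2 fun m => Measure.ae_eval_ne (fun _ : Fin d => (volume : Measure ℝ)) i (m / α)
  have h2 : ∀ᵐ y : EuclideanSpace ℝ (Fin d), ∀ m : ℤ, y i ≠ m / α :=
    (PiLp.volume_preserving_ofLp (Fin d)).quasiMeasurePreserving.ae h1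
  filter_upwards [h2] with y hy
  refine (hasLineDerivAt_latticeInterp_hat hh α i y fun m hm => hy m ?_).lineDeriv
  rw [← hm]
  field_simp

/-- Integration by parts for Lipschitz functions gives the identity along each coordinate vector. A
general direction follows by linearity, and the local integrability of the gradient comes from its
square integrability. -/
lemma hasWeakGradient_latticeInterp_hat {h : (Fin d → ℤ) → ℝ} (hh : h.support.Finite) {α : ℝ}
    (hα : 0 < α) :
    HasWeakGradient (latticeInterp α (fun _ => hatKernel) h) (interpGradient α h) := by
  obtain ⟨C, hC⟩ := exists_lipschitzWith_latticeInterp_hat hh hα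
  have hcont := hC.continuous
  have hG : LocallyIntegrable (interpGradient α h) volume :=
    (memLp_interpGradient hh hα).locallyIntegrable (by norm_num)
  refine ⟨hcont.locallyIntegrable, hG, fun φ hφ hφs v => ?_⟩
  obtain ⟨D, hD⟩ := hφ.lipschitzWith_of_hasCompactSupport hφs (by simp)
  have hcoord : ∀ i, ∫ y, latticeInterp α (fun _ => hatKernel) h y *
      fderiv ℝ φ y (EuclideanSpace.single i 1) = -∫ y, interpPartial α h i y * φ y := by
    intro i
    have h1 := hC.integral_lineDeriv_mul_eq hD hφs (EuclideanSpace.single i (1 : ℝ))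
      (μ := (volume : Measure (EuclideanSpace ℝ (Fin d))))
    have h2 : ∫ y, lineDeriv ℝ (latticeInterp α (fun _ => hatKernel) h) y
        (EuclideanSpace.single i 1) * φ y = ∫ y, interpPartial α h i y * φ y := by
      refine integral_congr_ae ?_
      filter_upwards [ae_lineDeriv_latticeInterp_hat hh hα i] with y hy
      rw [hy]
    rw [h2] at h1
    rw [h1, ← integral_neg]
    refine integral_congr_ae (ae_of_all _ fun y => ?_)
    have hd : DifferentiableAt ℝ φ y := (hφ.differentiable (by simp)) y
    simp only [hd.lineDeriv_eq_fderiv, map_neg]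
    ring
  have hv : v = ∑ i, v i • EuclideanSpace.single i (1 : ℝ) := by
    ext j
    simp [Finset.sum_apply, Pi.single_apply]
  have hfd : Continuous (fderiv ℝ φ) := hφ.continuous_fderiv (by simp)
  have hfs : HasCompactSupport (fderiv ℝ φ) := hφs.fderiv ℝ
  have hint1 : ∀ i, Integrable (fun y => v i * (latticeInterp α (fun _ => hatKernel) h y *
      fderiv ℝ φ y (EuclideanSpace.single i 1))) volume := by
    intro i
    refine Integrable.const_mul ?_ _
    refine (hcont.mul (hfd.clm_apply continuous_const)).integrable_of_hasCompactSupport ?_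
    refine HasCompactSupport.mul_left ?_
    exact hfs.comp_left (g := fun T : EuclideanSpace ℝ (Fin d) →L[ℝ] ℝ =>
      T (EuclideanSpace.single i 1)) rfl
  have hint2 : ∀ i, Integrable (fun y => v i * (interpPartial α h i y * φ y)) volume := by
    intro i
    refine Integrable.const_mul ?_ _
    have h3 := hG.integrable_smul_left_of_hasCompactSupport hφ.continuous hφs
    have h4 := (EuclideanSpace.proj (𝕜 := ℝ) i).integrable_comp h3
    refine h4.congr (ae_of_all _ fun y => ?_)
    simp [interpGradient, mul_comm]
  calc ∫ y, latticeInterp α (fun _ => hatKernel) h y * fderiv ℝ φ y v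
      = ∫ y, ∑ i, v i * (latticeInterp α (fun _ => hatKernel) h y *
          fderiv ℝ φ y (EuclideanSpace.single i 1)) := by
        refine integral_congr_ae (ae_of_all _ fun y => ?_)
        conv_lhs => rw [hv]
        simp only [map_sum, map_smul, smul_eq_mul, Finset.mul_sum]
        exact Finset.sum_congr rfl fun i _ => by ring
    _ = -∫ y, ∑ i, v i * (interpPartial α h i y * φ y) := by
        rw [integral_finsetSum _ fun i _ => hint1 i, integral_finsetSum _ fun i _ => hint2 i,
          ← Finset.sum_neg_distrib]
        refine Finset.sum_congr rfl fun i _ => ?_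
        rw [integral_const_mul, integral_const_mul, hcoord]
        ring
    _ = _ := by
        congr 1
        refine integral_congr_ae (ae_of_all _ fun y => ?_)
        simp only [PiLp.inner_apply, interpGradient, RCLike.inner_apply, conj_trivial,
          Finset.sum_mul]
        exact Finset.sum_congr rfl fun i _ => by ring

/-! ### Homogeneity and the bound for finitely supported functions -/

lemma HasWeakGradient.const_smul {h : EuclideanSpace ℝ (Fin d) → ℝ}
    {G : EuclideanSpace ℝ (Fin d) → EuclideanSpace ℝ (Fin d)} (hG : HasWeakGradient h G) (c : ℝ) :
    HasWeakGradient (c • h) (c • G) where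
  locallyIntegrable := hG.locallyIntegrable.smul c
  locallyIntegrable_grad := hG.locallyIntegrable_grad.smul c
  integral_eq φ hφ hφs v := by
    have h1 := hG.integral_eq φ hφ hφs v
    simp only [Pi.smul_apply, smul_eq_mul, inner_smul_left, conj_trivial, mul_assoc]
    rw [integral_const_mul, integral_const_mul, h1]
    ring

/-- By homogeneity the variational formula bounds the energy of any function. -/
lemma rhoContinuous_mul_sq_le {p : ℝ} (a : ℝ) {h : EuclideanSpace ℝ (Fin d) → ℝ}
    {G : EuclideanSpace ℝ (Fin d) → EuclideanSpace ℝ (Fin d)} (hG : HasWeakGradient h G)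
    (hh : MemLp h (ENNReal.ofReal (2 * p)) volume)
    (h0 : eLpNorm h (ENNReal.ofReal (2 * p)) volume ≠ 0) :
    rhoContinuous d p a * eLpNorm h (ENNReal.ofReal (2 * p)) volume ^ 2 ≤
      ENNReal.ofReal a * eLpNorm h 2 volume ^ 2 +
        ENNReal.ofReal (1 / 2) * eLpNorm G 2 volume ^ 2 := by
  set m := eLpNorm h (ENNReal.ofReal (2 * p)) volume with hm
  have htop : m ≠ ⊤ := hh.eLpNorm_ne_top
  let c : ℝ := (m⁻¹).toReal
  have hc : ‖c‖ₑ = m⁻¹ := by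
    rw [Real.enorm_of_nonneg ENNReal.toReal_nonneg, ENNReal.ofReal_toReal]
    simpa using h0
  have hle : rhoContinuous d p a ≤ ENNReal.ofReal a * eLpNorm (c • h) 2 volume ^ 2 +
      ENNReal.ofReal (1 / 2) * eLpNorm (c • G) 2 volume ^ 2 := by
    have hone : eLpNorm (c • h) (ENNReal.ofReal (2 * p)) volume = 1 := by
      rw [eLpNorm_const_smul, hc, ← hm, ENNReal.inv_mul_cancel h0 htop]
    exact iInf_le_of_le (c • h) (iInf_le_of_le (c • G) (iInf_le_of_le (hh.const_smul c)
      (iInf_le_of_le hone (iInf_le_of_le (hG.const_smul c) le_rfl))))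
  rw [eLpNorm_const_smul, eLpNorm_const_smul, hc] at hle
  calc rhoContinuous d p a * m ^ 2
      ≤ (ENNReal.ofReal a * (m⁻¹ * eLpNorm h 2 volume) ^ 2 +
          ENNReal.ofReal (1 / 2) * (m⁻¹ * eLpNorm G 2 volume) ^ 2) * m ^ 2 := by gcongr
    _ = (m⁻¹ * m) ^ 2 * (ENNReal.ofReal a * eLpNorm h 2 volume ^ 2 +
          ENNReal.ofReal (1 / 2) * eLpNorm G 2 volume ^ 2) := by ring
    _ = _ := by rw [ENNReal.inv_mul_cancel h0 htop, one_pow, one_mul]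

/-- Superadditivity of `t ↦ t ^ p`, extended from two terms by induction; it is the source of `ℓ² ⊆
ℓ^{2p}`. -/
lemma ENNReal.sum_rpow_le_rpow_sum {ι : Type*} (S : Finset ι) (f : ι → ℝ≥0∞) {p : ℝ} (hp : 1 ≤ p) :
    ∑ x ∈ S, f x ^ p ≤ (∑ x ∈ S, f x) ^ p := by
  classical
  induction S using Finset.induction_on with
  | empty => simp
  | insert i S hi ih =>
    rw [Finset.sum_insert hi, Finset.sum_insert hi]
    exact (add_le_add_right ih _).trans (ENNReal.add_rpow_le_rpow_add _ _ hp)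

/-- The `ℓ^{2p}`-norm is bounded by the `ℓ²`-norm. -/
lemma tsum_enorm_rpow_two_mul_le {ι : Type*} (u : ι → ℝ) {p : ℝ} (hp : 1 ≤ p) :
    (∑' x, ‖u x‖ₑ ^ (2 * p)) ^ (1 / (2 * p)) ≤ (∑' x, ‖u x‖ₑ ^ (2 : ℝ)) ^ (1 / 2 : ℝ) := by
  have h1 : ∑' x, ‖u x‖ₑ ^ (2 * p) ≤ (∑' x, ‖u x‖ₑ ^ (2 : ℝ)) ^ p := by
    rw [ENNReal.tsum_eq_iSup_sum]
    refine iSup_le fun S => ?_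
    simp_rw [ENNReal.rpow_mul]
    exact (ENNReal.sum_rpow_le_rpow_sum S _ hp).trans
      (ENNReal.rpow_le_rpow (ENNReal.sum_le_tsum S) (by linarith))
  refine (ENNReal.rpow_le_rpow h1 (by positivity)).trans_eq ?_
  rw [← ENNReal.rpow_mul]
  congr 1
  field_simp

/-- Lower bound for the energy of a finitely supported lattice function on the lattice of spacing
`α⁻¹` by the continuous variational formula. -/
lemma rhoContinuous_mul_le_discrete {p a α : ℝ} (hp : 1 < p) (ha : 0 ≤ a) (hα : 0 < α)
    {h : (Fin d → ℤ) → ℝ} (hh : h.support.Finite) {X Z P : ℝ} (hX0 : 0 ≤ X) (hZ0 : 0 ≤ Z)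
    (hX : ∑' x, ‖h x‖ₑ ^ (2 : ℝ) ≤ ENNReal.ofReal X)
    (hZ : ∑ i, ∑' x, ‖forwardDiff i h x‖ₑ ^ (2 : ℝ) ≤ ENNReal.ofReal Z)
    (hP : ENNReal.ofReal P ≤ (∑' x, ‖h x‖ₑ ^ (2 * p)) ^ (1 / (2 * p)))
    (hPZ : d * √Z < P) :
    rhoContinuous d p a *
        ENNReal.ofReal ((((α⁻¹) ^ d) ^ (1 / (2 * p)) * (P - d * √Z)) ^ 2) ≤
      ENNReal.ofReal (a * ((α⁻¹) ^ d * X) + 1 / 2 * (α ^ 2 * (α⁻¹) ^ d * Z)) := by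
  have hp2 : 0 < 2 * p := by linarith
  have hk : ∀ _i : Fin d, IsSubKernel hatKernel := fun _ => isSubKernel_hatKernel
  set b : ℝ := ((α⁻¹) ^ d) ^ (1 / (2 * p)) with hb
  have hb0 : 0 < b := by positivity
  have hbE : ENNReal.ofReal ((α⁻¹) ^ d) ^ (1 / (2 * p)) = ENNReal.ofReal b := by
    rw [ENNReal.ofReal_rpow_of_pos (by positivity)]
  set g := latticeInterp α (fun _ => hatKernel) h with hg
  have h1 := eLpNorm_box_le_hat_add hh hα (s := 2 * p) (by linarith)
  have h2 : ENNReal.ofReal (b * P) ≤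
      eLpNorm (latticeInterp α (fun _ => boxKernel) h) (ENNReal.ofReal (2 * p)) volume := by
    rw [eLpNorm_latticeInterp_box h hα hp2, ENNReal.mul_rpow_of_nonneg _ _ (by positivity), hbE,
      ENNReal.ofReal_mul hb0.le]
    gcongr
  -- The embedding `ℓ² ⊆ ℓ^{2p}` bounds the interpolation loss in terms of the Dirichlet energy
  -- alone.
  have h3 : ∀ i, eLpNorm (latticeInterp α (fun _ => boxKernel) (forwardDiff i h))
      (ENNReal.ofReal (2 * p)) volume ≤ ENNReal.ofReal (b * √Z) := by
    intro i
    rw [eLpNorm_latticeInterp_box _ hα hp2, ENNReal.mul_rpow_of_nonneg _ _ (by positivity), hbE,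
      ENNReal.ofReal_mul hb0.le]
    gcongr
    refine (tsum_enorm_rpow_two_mul_le _ hp.le).trans ?_
    rw [Real.sqrt_eq_rpow, ← ENNReal.ofReal_rpow_of_nonneg hZ0 (by norm_num)]
    refine ENNReal.rpow_le_rpow (le_trans ?_ hZ) (by norm_num)
    exact Finset.single_le_sum (f := fun i => ∑' x, ‖forwardDiff i h x‖ₑ ^ (2 : ℝ))
      (fun _ _ => zero_le) (Finset.mem_univ i)
  have h4 : ENNReal.ofReal (b * P) ≤ eLpNorm g (ENNReal.ofReal (2 * p)) volume +
      ENNReal.ofReal (b * (d * √Z)) := by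
    refine (h2.trans h1).trans ?_
    gcongr
    refine (Finset.sum_le_sum fun i _ => h3 i).trans_eq ?_
    rw [Finset.sum_const, Finset.card_univ, Fintype.card_fin, nsmul_eq_mul,
      ← ENNReal.ofReal_natCast, ← ENNReal.ofReal_mul (by positivity)]
    congr 1
    ring
  have h5 : ENNReal.ofReal (b * (P - d * √Z)) ≤ eLpNorm g (ENNReal.ofReal (2 * p)) volume := by
    rw [mul_sub, ENNReal.ofReal_sub _ (by positivity)]
    exact tsub_le_iff_right.2 h4
  have hpos : 0 < b * (P - d * √Z) := mul_pos hb0 (by linarith)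
  have hne : eLpNorm g (ENNReal.ofReal (2 * p)) volume ≠ 0 := by
    have : 0 < ENNReal.ofReal (b * (P - d * √Z)) := ENNReal.ofReal_pos.2 hpos
    exact (this.trans_le h5).ne'
  have h6 := rhoContinuous_mul_sq_le a (hasWeakGradient_latticeInterp_hat hh hα)
    (memLp_latticeInterp hh hk hα (by linarith)) hne
  calc rhoContinuous d p a * ENNReal.ofReal ((b * (P - d * √Z)) ^ 2)
      ≤ rhoContinuous d p a * eLpNorm g (ENNReal.ofReal (2 * p)) volume ^ 2 := by
        rw [ENNReal.ofReal_pow hpos.le]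
        gcongr
    _ ≤ _ := h6
    _ ≤ ENNReal.ofReal a * (ENNReal.ofReal ((α⁻¹) ^ d) * ENNReal.ofReal X) +
        ENNReal.ofReal (1 / 2) * (ENNReal.ofReal (α ^ 2 * (α⁻¹) ^ d) * ENNReal.ofReal Z) := by
        gcongr
        · exact (eLpNorm_latticeInterp_two_sq_le hh hk hα).trans (by gcongr)
        · exact (eLpNorm_interpGradient_two_sq_le hh hα).trans (by gcongr)
    _ = _ := by
        rw [ENNReal.ofReal_add (by positivity) (by positivity), ENNReal.ofReal_mul ha,
          ENNReal.ofReal_mul (p := (α⁻¹) ^ d) (by positivity),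
          ENNReal.ofReal_mul (p := 1 / 2) (by norm_num),
          ENNReal.ofReal_mul (p := α ^ 2 * (α⁻¹) ^ d) (by positivity)]

/-! ### Periodic functions and sums over a period cell -/

/-- The lattice point of a point of the period cell. -/
def cellPoint {L : ℕ} (x : Fin d → Fin L) : Fin d → ℤ := fun i => ((x i : ℕ) : ℤ)

lemma cellPoint_injective {L : ℕ} : Function.Injective (cellPoint : (Fin d → Fin L) → Fin d → ℤ) := by
  intro x y h
  funext i
  have := congrFun h i
  simp only [cellPoint, Nat.cast_inj] at this
  exact Fin.ext this

lemma mem_range_cellPoint {L : ℕ} {x : Fin d → ℤ} (h : ∀ i, 0 ≤ x i ∧ x i < L) :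
    x ∈ Set.range (cellPoint : (Fin d → Fin L) → Fin d → ℤ) := by
  refine ⟨fun i => ⟨(x i).toNat, by have := h i; omega⟩, funext fun i => ?_⟩
  simp [cellPoint, (h i).1]

lemma IsPeriodic.apply_add_mul {L : ℕ} {f : (Fin d → ℤ) → ℝ} (hf : IsPeriodic L f)
    (x m : Fin d → ℤ) : f (x + fun i => m i * L) = f x := by
  classical
  have key : ∀ S : Finset (Fin d), f (x + ∑ i ∈ S, m i • Pi.single i (L : ℤ)) = f x := by
    intro S
    induction S using Finset.induction_on with
    | empty => simp
    | insert i S hi ih =>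
      rw [Finset.sum_insert hi, add_comm (m i • _), ← add_assoc]
      have hper : Function.Periodic f (Pi.single i (L : ℤ)) := fun y => hf y i
      rw [hper.zsmul (m i), ih]
  rw [← key Finset.univ]
  congr 2
  funext j
  simp [Finset.sum_apply, Pi.single_apply]

/-- Translation followed by reduction modulo `L` is an injective self-map of the finite cell, hence
a permutation of it, and periodicity makes the reduction harmless. -/
lemma IsPeriodic.sum_cell_shift {L : ℕ} (hL : 0 < L) {f : (Fin d → ℤ) → ℝ} (hf : IsPeriodic L f)
    (τ : Fin d → ℤ) :
    ∑ x : Fin d → Fin L, f (cellPoint x + τ) = ∑ x : Fin d → Fin L, f (cellPoint x) := by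
  have hLz : (0 : ℤ) < L := by exact_mod_cast hL
  have hmod : ∀ z : ℤ, 0 ≤ z % L ∧ z % L < L := fun z =>
    ⟨Int.emod_nonneg z hLz.ne', Int.emod_lt_of_pos z hLz⟩
  let σ : (Fin d → Fin L) → Fin d → Fin L := fun x i =>
    ⟨((cellPoint x i + τ i) % L).toNat, by have := hmod (cellPoint x i + τ i); omega⟩
  have hσ : ∀ x i, cellPoint (σ x) i = (cellPoint x i + τ i) % L := fun x i => by
    simp [cellPoint, σ, Int.emod_nonneg _ hLz.ne']
  have hinj : Function.Injective σ := by
    intro x y hxy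
    funext i
    have h1 : (cellPoint x i + τ i) % L = (cellPoint y i + τ i) % L := by
      rw [← hσ, ← hσ, hxy]
    have h2 : (L : ℤ) ∣ cellPoint x i - cellPoint y i := by
      have h3 : (L : ℤ) ∣ _ := Int.ModEq.dvd h1.symm
      simpa using h3
    have h4 : cellPoint x i - cellPoint y i = 0 := by
      refine Int.eq_zero_of_abs_lt_dvd h2 ?_
      have hx := (x i).2
      have hy := (y i).2
      simp only [cellPoint]
      rw [abs_lt]
      constructor <;> omega
    simp only [cellPoint] at h4
    apply Fin.ext
    omega
  refine Fintype.sum_bijective σ (Finite.injective_iff_bijective.1 hinj) _ _ fun x => ?_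
  rw [← hf.apply_add_mul (cellPoint (σ x)) fun i => (cellPoint x i + τ i) / L]
  congr 1
  funext i
  simp only [Pi.add_apply, hσ]
  rw [mul_comm, Int.emod_add_mul_ediv]

/-- Pigeonhole: some translation of a periodic function has at least the average mass on a given
subset of the cell. -/
lemma IsPeriodic.exists_shift {L : ℕ} (hL : 0 < L) {f : (Fin d → ℤ) → ℝ} (hf : IsPeriodic L f)
    (A : Finset (Fin d → Fin L)) :
    ∃ τ : Fin d → ℤ, (A.card : ℝ) * ∑ x : Fin d → Fin L, f (cellPoint x) ≤
      (L : ℝ) ^ d * ∑ x ∈ A, f (cellPoint x + τ) := by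
  have : Nonempty (Fin d → Fin L) := ⟨fun _ => ⟨0, hL⟩⟩
  -- Double counting: for each fixed `x ∈ A`, the point `x + τ` runs through a full period as `τ`
  -- does.
  have h1 : ∑ τ : Fin d → Fin L, ∑ x ∈ A, f (cellPoint x + cellPoint τ) =
      A.card * ∑ x : Fin d → Fin L, f (cellPoint x) := by
    rw [Finset.sum_comm, ← nsmul_eq_mul, ← Finset.sum_const]
    refine Finset.sum_congr rfl fun x _ => ?_
    rw [← hf.sum_cell_shift hL (cellPoint x)]
    exact Finset.sum_congr rfl fun τ _ => by rw [add_comm]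
  obtain ⟨τ, -, hτ⟩ := Finset.exists_le_of_sum_le (s := (Finset.univ : Finset (Fin d → Fin L)))
    Finset.univ_nonempty
    (f := fun _ => (A.card : ℝ) * ∑ x : Fin d → Fin L, f (cellPoint x))
    (g := fun τ => (L : ℝ) ^ d * ∑ x ∈ A, f (cellPoint x + cellPoint τ)) (by
      rw [← Finset.mul_sum Finset.univ _ ((L : ℝ) ^ d), h1]
      simp)
  exact ⟨_, hτ⟩

lemma tsum_enorm_rpow_eq_sum_cell {L : ℕ} {u : (Fin d → ℤ) → ℝ}
    (hu : u.support ⊆ Set.range (cellPoint : (Fin d → Fin L) → Fin d → ℤ)) {s : ℝ} (hs : 0 < s) :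
    ∑' x, ‖u x‖ₑ ^ s = ENNReal.ofReal (∑ x : Fin d → Fin L, |u (cellPoint x)| ^ s) := by
  rw [← cellPoint_injective.tsum_eq, tsum_fintype, ENNReal.ofReal_sum_of_nonneg]
  · refine Finset.sum_congr rfl fun x _ => ?_
    rw [← ENNReal.ofReal_rpow_of_nonneg (abs_nonneg _) hs.le, ← Real.norm_eq_abs, ofReal_norm]
  · intro x _
    positivity
  · intro x hx
    apply hu
    intro h0
    apply hx
    simp [h0, hs]

/-! ### Cutting off a periodic function -/

/-- The one-dimensional cutoff: it vanishes outside `(0, L)`, equals one on `[w, L - w]` and has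
slope at most `1 / w`. -/
def cutoff (L w : ℕ) (m : ℤ) : ℝ := max 0 (min 1 (min ((m : ℝ) / w) (((L : ℝ) - m) / w)))

lemma cutoff_nonneg (L w : ℕ) (m : ℤ) : 0 ≤ cutoff L w m := le_max_left _ _

lemma cutoff_le_one (L w : ℕ) (m : ℤ) : cutoff L w m ≤ 1 := max_le zero_le_one (min_le_left _ _)

lemma abs_cutoff_le_one (L w : ℕ) (m : ℤ) : |cutoff L w m| ≤ 1 := by
  rw [abs_of_nonneg (cutoff_nonneg L w m)]
  exact cutoff_le_one L w m

lemma cutoff_ne_zero {L w : ℕ} {m : ℤ} (h : cutoff L w m ≠ 0) : 0 < m ∧ m < L := by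
  have hw : (0 : ℝ) ≤ w := by positivity
  constructor
  · by_contra hm
    apply h
    have : (m : ℝ) ≤ 0 := by exact_mod_cast not_lt.1 hm
    exact max_eq_left ((min_le_right _ _).trans ((min_le_left _ _).trans
      (div_nonpos_of_nonpos_of_nonneg this hw)))
  · by_contra hm
    apply h
    have : (L : ℝ) ≤ m := by exact_mod_cast not_lt.1 hm
    exact max_eq_left ((min_le_right _ _).trans ((min_le_right _ _).trans
      (div_nonpos_of_nonpos_of_nonneg (by linarith) hw)))

lemma cutoff_eq_one {L w : ℕ} (hw : 0 < w) {m : ℤ} (h1 : (w : ℤ) ≤ m) (h2 : m + w ≤ L) :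
    cutoff L w m = 1 := by
  have hw' : (0 : ℝ) < w := by exact_mod_cast hw
  have h1' : (w : ℝ) ≤ m := by exact_mod_cast h1
  have h2' : (m : ℝ) + w ≤ L := by exact_mod_cast h2
  have h3 : (1 : ℝ) ≤ m / w := by rwa [one_le_div hw']
  have h4 : (1 : ℝ) ≤ (L - m) / w := by rw [one_le_div hw']; linarith
  rw [cutoff, min_eq_left (le_min h3 h4), max_eq_right zero_le_one]

lemma abs_cutoff_succ_sub_le (L w : ℕ) (m : ℤ) : |cutoff L w (m + 1) - cutoff L w m| ≤ 1 / w := by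
  have hw : (0 : ℝ) ≤ 1 / w := by positivity
  refine (abs_max_sub_max_le_max _ _ _ _).trans (max_le (by simp) ?_)
  refine (abs_min_sub_min_le_max _ _ _ _).trans (max_le (by simp) ?_)
  refine (abs_min_sub_min_le_max _ _ _ _).trans (max_le (le_of_eq ?_) (le_of_eq ?_))
  · push_cast
    rw [← sub_div, add_sub_cancel_left, abs_of_nonneg hw]
  · push_cast
    rw [← sub_div, show (L : ℝ) - (m + 1) - (L - m) = -1 by ring, neg_div, abs_neg,
      abs_of_nonneg hw]

/-- The product cutoff on the period cell. -/
def cellCutoff (L w : ℕ) (x : Fin d → ℤ) : ℝ := ∏ i, cutoff L w (x i)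

lemma cellCutoff_ne_zero {L w : ℕ} {x : Fin d → ℤ} (h : cellCutoff L w x ≠ 0) (i : Fin d) :
    0 < x i ∧ x i < L := by
  rw [cellCutoff, Finset.prod_ne_zero_iff] at h
  exact cutoff_ne_zero (h i (Finset.mem_univ i))

lemma abs_cellCutoff_le_one (L w : ℕ) (x : Fin d → ℤ) : |cellCutoff L w x| ≤ 1 := by
  rw [cellCutoff, Finset.abs_prod]
  exact Finset.prod_le_one (fun _ _ => abs_nonneg _) fun i _ => abs_cutoff_le_one L w _

lemma abs_cellCutoff_sub_le (L w : ℕ) (x : Fin d → ℤ) (i : Fin d) :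
    |cellCutoff L w (x + Pi.single i 1) - cellCutoff L w x| ≤ 1 / w := by
  refine (abs_prod_sub_prod_le _ _ _ (fun j => abs_cutoff_le_one L w _)
    fun j => abs_cutoff_le_one L w _).trans ?_
  rw [Finset.sum_eq_single i]
  · simpa using abs_cutoff_succ_sub_le L w (x i)
  · intro j _ hj
    simp [hj]
  · simp

/-- The cutoff vanishes at coordinate `0` as well as at `L`. Hence the difference at coordinate `-1`
is zero, and the unit shift does not leave the cell. -/
lemma forwardDiff_cellCutoff_mul_support (L w : ℕ) (f : (Fin d → ℤ) → ℝ) (i : Fin d) :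
    (forwardDiff i fun x => cellCutoff L w x * f x).support ⊆
      Set.range (cellPoint : (Fin d → Fin L) → Fin d → ℤ) := by
  intro x hx
  apply mem_range_cellPoint
  have h : cellCutoff L w (x + Pi.single i 1) ≠ 0 ∨ cellCutoff L w x ≠ 0 := by
    by_contra! h
    apply hx
    simp [forwardDiff, h.1, h.2]
  intro j
  rcases h with h | h
  · have := cellCutoff_ne_zero h j
    rcases eq_or_ne j i with rfl | hj
    · simp only [Pi.add_apply, Pi.single_eq_same] at this
      omega
    · simp only [Pi.add_apply, Pi.single_eq_of_ne hj, add_zero] at this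
      omega
  · have := cellCutoff_ne_zero h j
    omega

/-- Discrete Leibniz rule followed by Young's inequality with parameter `δ`. -/
lemma sq_forwardDiff_cellCutoff_mul_le (L w : ℕ) (f : (Fin d → ℤ) → ℝ) (i : Fin d)
    {δ : ℝ} (hδ : 0 < δ) (x : Fin d → ℤ) :
    |forwardDiff i (fun x => cellCutoff L w x * f x) x| ^ (2 : ℝ) ≤
      (1 + δ) * forwardDiff i f x ^ 2 + (1 + 1 / δ) * (1 / w) ^ 2 * f x ^ 2 := by
  rw [Real.rpow_two, sq_abs]
  set A := cellCutoff L w (x + Pi.single i 1) * forwardDiff i f x with hA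
  set B := (cellCutoff L w (x + Pi.single i 1) - cellCutoff L w x) * f x with hB
  have h1 : forwardDiff i (fun x => cellCutoff L w x * f x) x = A + B := by
    simp only [forwardDiff, hA, hB]
    ring
  have h2 : A ^ 2 ≤ forwardDiff i f x ^ 2 := by
    rw [hA, mul_pow]
    refine mul_le_of_le_one_left (sq_nonneg _) ?_
    rw [sq_le_one_iff_abs_le_one]
    exact abs_cellCutoff_le_one L w _
  have h3 : B ^ 2 ≤ (1 / w) ^ 2 * f x ^ 2 := by
    rw [hB, mul_pow]
    refine mul_le_mul_of_nonneg_right ?_ (sq_nonneg _)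
    rw [← sq_abs]
    gcongr
    exact abs_cellCutoff_sub_le L w x i
  have h4 : (A + B) ^ 2 ≤ (1 + δ) * A ^ 2 + (1 + 1 / δ) * B ^ 2 := by
    have h5 : (1 + δ) * A ^ 2 + (1 + 1 / δ) * B ^ 2 - (A + B) ^ 2 = (δ * A - B) ^ 2 / δ := by
      field_simp
      ring
    have h6 : 0 ≤ (δ * A - B) ^ 2 / δ := by positivity
    linarith
  rw [h1, mul_assoc]
  refine h4.trans ?_
  gcongr

lemma forwardDiff_comp_add (i : Fin d) (h : (Fin d → ℤ) → ℝ) (τ x : Fin d → ℤ) :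
    forwardDiff i (fun y => h (y + τ)) x = forwardDiff i h (x + τ) := by
  simp only [forwardDiff]
  rw [add_right_comm]

lemma IsPeriodic.forwardDiff {L : ℕ} {h : (Fin d → ℤ) → ℝ} (hh : IsPeriodic L h) (i : Fin d) :
    IsPeriodic L (forwardDiff i h) := by
  intro x j
  rw [_root_.forwardDiff, _root_.forwardDiff, add_right_comm, hh, hh]

lemma IsPeriodic.comp {L : ℕ} {h : (Fin d → ℤ) → ℝ} (hh : IsPeriodic L h) (F : ℝ → ℝ) :
    IsPeriodic L fun x => F (h x) := fun x j => by
  simp only [hh x j]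

/-- A periodic function can be translated and cut off inside one period cell at the cost of a
boundary layer of width `w`. -/
lemma IsPeriodic.exists_cutoff {L w n : ℕ} (hL : 0 < L) (hw : 0 < w) (hn : n + 2 * w ≤ L)
    {h : (Fin d → ℤ) → ℝ} (hh : IsPeriodic L h) {s δ : ℝ} (hs : 0 < s) (hδ : 0 < δ) :
    ∃ k : (Fin d → ℤ) → ℝ, k.support.Finite ∧
      ∑' x, ‖k x‖ₑ ^ (2 : ℝ) ≤ ENNReal.ofReal (∑ x : Fin d → Fin L, h (cellPoint x) ^ 2) ∧
      ∑ i, ∑' x, ‖_root_.forwardDiff i k x‖ₑ ^ (2 : ℝ) ≤ ENNReal.ofReal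
        ((1 + δ) * (∑ i, ∑ x : Fin d → Fin L, _root_.forwardDiff i h (cellPoint x) ^ 2) +
          (1 + 1 / δ) * (1 / w) ^ 2 * d * ∑ x : Fin d → Fin L, h (cellPoint x) ^ 2) ∧
      ENNReal.ofReal (((n : ℝ) / L) ^ d * ∑ x : Fin d → Fin L, |h (cellPoint x)| ^ s) ≤
        ∑' x, ‖k x‖ₑ ^ s := by
  classical
  -- The inner cube with coordinates in `[w, w + n)`, where `n + 2 * w ≤ L` forces the cutoff to be
  -- one.
  let e : (Fin d → Fin n) → Fin d → Fin L := fun x i => ⟨w + x i, by have := (x i).2; omega⟩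
  have he : Function.Injective e := by
    intro x y hxy
    funext i
    have := congrArg Fin.val (congrFun hxy i)
    apply Fin.ext
    simp only [e] at this
    omega
  let A : Finset (Fin d → Fin L) := Finset.univ.image e
  have hA : A.card = n ^ d := by
    rw [Finset.card_image_of_injective _ he]
    simp
  have hAmem : ∀ x ∈ A, cellCutoff L w (cellPoint x) = 1 := by
    intro x hx
    obtain ⟨y, -, rfl⟩ := Finset.mem_image.1 hx
    refine Finset.prod_eq_one fun i _ => cutoff_eq_one hw ?_ ?_
    · simp [cellPoint, e]
    · have := (y i).2
      simp only [cellPoint, e]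
      push_cast
      omega
  -- The translation is chosen for the `s`-mass only; the other two sums over a period do not depend
  -- on it.
  obtain ⟨τ, hτ⟩ := (hh.comp fun u => |u| ^ s).exists_shift hL A
  let f : (Fin d → ℤ) → ℝ := fun x => h (x + τ)
  let k : (Fin d → ℤ) → ℝ := fun x => cellCutoff L w x * f x
  have hksupp : k.support ⊆ Set.range (cellPoint : (Fin d → Fin L) → Fin d → ℤ) := by
    intro x hx
    apply mem_range_cellPoint
    intro i
    have h1 := cellCutoff_ne_zero (left_ne_zero_of_mul hx) i
    omega
  have hf2 : ∑ x : Fin d → Fin L, f (cellPoint x) ^ 2 =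
      ∑ x : Fin d → Fin L, h (cellPoint x) ^ 2 :=
    (hh.comp fun u => u ^ 2).sum_cell_shift hL τ
  refine ⟨k, (Set.finite_range _).subset hksupp, ?_, ?_, ?_⟩
  · rw [tsum_enorm_rpow_eq_sum_cell hksupp (by norm_num), ← hf2]
    refine ENNReal.ofReal_le_ofReal (Finset.sum_le_sum fun x _ => ?_)
    rw [Real.rpow_two, sq_abs, mul_pow]
    refine mul_le_of_le_one_left (sq_nonneg _) ?_
    rw [sq_le_one_iff_abs_le_one]
    exact abs_cellCutoff_le_one L w _
  · have h1 : ∀ i, ∑ x : Fin d → Fin L, |_root_.forwardDiff i k (cellPoint x)| ^ (2 : ℝ) ≤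
        (1 + δ) * ∑ x : Fin d → Fin L, _root_.forwardDiff i h (cellPoint x) ^ 2 +
          (1 + 1 / δ) * (1 / w) ^ 2 * ∑ x : Fin d → Fin L, h (cellPoint x) ^ 2 := by
      intro i
      rw [← ((hh.forwardDiff i).comp fun u => u ^ 2).sum_cell_shift hL τ, ← hf2, Finset.mul_sum,
        Finset.mul_sum, ← Finset.sum_add_distrib]
      refine Finset.sum_le_sum fun x _ => ?_
      rw [← forwardDiff_comp_add]
      exact sq_forwardDiff_cellCutoff_mul_le L w f i hδ (cellPoint x)
    have h2 : ∀ i, ∑' x, ‖_root_.forwardDiff i k x‖ₑ ^ (2 : ℝ) = ENNReal.ofReal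
        (∑ x : Fin d → Fin L, |_root_.forwardDiff i k (cellPoint x)| ^ (2 : ℝ)) := fun i =>
      tsum_enorm_rpow_eq_sum_cell (forwardDiff_cellCutoff_mul_support L w f i) (by norm_num)
    simp_rw [h2]
    rw [← ENNReal.ofReal_sum_of_nonneg fun i _ => Finset.sum_nonneg fun x _ => by positivity]
    refine ENNReal.ofReal_le_ofReal ((Finset.sum_le_sum fun i _ => h1 i).trans_eq ?_)
    rw [Finset.sum_add_distrib, ← Finset.mul_sum, Finset.sum_const, Finset.card_univ,
      Fintype.card_fin, nsmul_eq_mul]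
    ring
  · rw [tsum_enorm_rpow_eq_sum_cell hksupp hs]
    refine ENNReal.ofReal_le_ofReal ?_
    have hL' : (0 : ℝ) < (L : ℝ) ^ d := by positivity
    rw [hA] at hτ
    push_cast at hτ
    calc ((n : ℝ) / L) ^ d * ∑ x : Fin d → Fin L, |h (cellPoint x)| ^ s
        = ((n : ℝ) ^ d * ∑ x : Fin d → Fin L, |h (cellPoint x)| ^ s) / (L : ℝ) ^ d := by
          rw [div_pow]
          ring
      _ ≤ ∑ x ∈ A, |h (cellPoint x + τ)| ^ s := by
          rw [div_le_iff₀ hL', mul_comm _ ((L : ℝ) ^ d)]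
          exact hτ
      _ = ∑ x ∈ A, |k (cellPoint x)| ^ s :=
          Finset.sum_congr rfl fun x hx => by simp only [k, f, hAmem x hx, one_mul]
      _ ≤ _ := Finset.sum_le_sum_of_subset_of_nonneg (Finset.subset_univ _)
          fun x _ _ => by positivity

/-! ### The energy of a periodic lattice function -/

lemma periodNorm_two_sq {E : Type*} [NormedAddCommGroup E] (L : ℕ) (f : (Fin d → ℤ) → E) :
    periodNorm 2 L f ^ 2 = ∑ x : Fin d → Fin L, ‖f (cellPoint x)‖ ^ 2 := by
  have h0 : 0 ≤ ∑ x : Fin d → Fin L, ‖f (cellPoint x)‖ ^ (2 : ℝ) :=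
    Finset.sum_nonneg fun x _ => by positivity
  have h1 : periodNorm 2 L f = √(∑ x : Fin d → Fin L, ‖f (cellPoint x)‖ ^ (2 : ℝ)) := by
    rw [Real.sqrt_eq_rpow]
    rfl
  rw [h1, Real.sq_sqrt h0]
  simp_rw [Real.rpow_two]

lemma norm_discreteGradient_sq (h : (Fin d → ℤ) → ℝ) (x : Fin d → ℤ) :
    ‖discreteGradient h x‖ ^ 2 = ∑ i, forwardDiff i h x ^ 2 := by
  simp [EuclideanSpace.norm_sq_eq, discreteGradient, forwardDiff]

lemma sum_eq_one_of_periodNorm_eq_one {s : ℝ} (hs : 0 < s) {L : ℕ} {h : (Fin d → ℤ) → ℝ}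
    (hh : periodNorm s L h = 1) : ∑ x : Fin d → Fin L, |h (cellPoint x)| ^ s = 1 := by
  have h0 : 0 ≤ ∑ x : Fin d → Fin L, |h (cellPoint x)| ^ s :=
    Finset.sum_nonneg fun x _ => by positivity
  have h1 : (∑ x : Fin d → Fin L, |h (cellPoint x)| ^ s) ^ (1 / s) = 1 := hh
  calc _ = ((∑ x : Fin d → Fin L, |h (cellPoint x)| ^ s) ^ (1 / s)) ^ s := by
        rw [← Real.rpow_mul h0, one_div_mul_cancel hs.ne', Real.rpow_one]
    _ = 1 := by rw [h1, Real.one_rpow]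

/-- The multiplicative loss in the energy caused by a cutoff over the macroscopic length `K`. -/
def cutoffLoss (d : ℕ) (a K : ℝ) : ℝ := 1 + 1 / K + (1 + K) * d / (2 * a * K ^ 2)

lemma cutoffLoss_pos {a K : ℝ} (ha : 0 < a) (hK : 0 < K) : 0 < cutoffLoss d a K := by
  unfold cutoffLoss
  positivity

/-- Young's parameter is `1 / K`. With `w ≥ K * α`, the cutoff error `(1 + K) * d * X / (2 * K ^ 2 *
α ^ 2)` is a fixed multiple, of order `1 / K`, of the mass term `a * (α ^ 2)⁻¹ * X`, so it can be
absorbed as a factor. -/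
lemma cutoff_energy_le {a α K X Y : ℝ} (ha : 0 < a) (hα : 0 < α) (hK : 0 < K) {w : ℕ}
    (hw : K * α ≤ w) (hX : 0 ≤ X) (hY : 0 ≤ Y) :
    a * (α ^ 2)⁻¹ * X +
        1 / 2 * ((1 + 1 / K) * Y + (1 + 1 / (1 / K)) * (1 / w) ^ 2 * d * X) ≤
      cutoffLoss d a K * (a * (α ^ 2)⁻¹ * X + 1 / 2 * Y) := by
  have h1 : (1 / (w : ℝ)) ^ 2 ≤ (1 / (K * α)) ^ 2 := by
    have : 0 < K * α := by positivity
    gcongr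
  have h2 : (1 + 1 / (1 / K)) * (1 / (w : ℝ)) ^ 2 * d * X ≤
      (1 + 1 / (1 / K)) * (1 / (K * α)) ^ 2 * d * X := by gcongr
  -- With `w` replaced by `K * α`, the slack is exactly the two unused cross terms of the product.
  have h3 : cutoffLoss d a K * (a * (α ^ 2)⁻¹ * X + 1 / 2 * Y) - (a * (α ^ 2)⁻¹ * X +
      1 / 2 * ((1 + 1 / K) * Y + (1 + 1 / (1 / K)) * (1 / (K * α)) ^ 2 * d * X)) =
      1 / K * (a * (α ^ 2)⁻¹ * X) + (1 + K) * d / (2 * a * K ^ 2) * (1 / 2 * Y) := by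
    unfold cutoffLoss
    field_simp
    ring
  have h4 : 0 ≤ 1 / K * (a * (α ^ 2)⁻¹ * X) + (1 + K) * d / (2 * a * K ^ 2) * (1 / 2 * Y) := by
    positivity
  linarith

/-- Comparing exponents, `2 - d = -d / p + (2 - d / q)`: the first part is the square of the
`2p`-normalisation, the second the scaling of the theorem. -/
lemma rpow_scaling {p q α : ℝ} (hpq : p.HolderConjugate q) (hα : 0 < α) (d : ℕ) :
    α ^ 2 * (α⁻¹) ^ d = (((α⁻¹) ^ d) ^ (1 / (2 * p))) ^ 2 * α ^ (2 - d / q) := by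
  have h1 : (α⁻¹) ^ d = α ^ (-(d : ℝ)) := by
    rw [Real.rpow_neg hα.le, Real.rpow_natCast, inv_pow]
  have h2 : α ^ 2 = α ^ (2 : ℝ) := (Real.rpow_two α).symm
  have hp : p ≠ 0 := hpq.ne_zero
  have hq : q ≠ 0 := hpq.symm.ne_zero
  have hinv := hpq.inv_add_inv_eq_one
  rw [h1, h2, ← Real.rpow_add hα, ← Real.rpow_two (_ ^ _), ← Real.rpow_mul hα.le,
    ← Real.rpow_mul hα.le, ← Real.rpow_add hα]
  congr 1
  have h3 : -(d : ℝ) * (1 / (2 * p)) * 2 = -(d * p⁻¹) := by field_simp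
  rw [h3, div_eq_mul_inv]
  linear_combination (d : ℝ) * hinv

/-- Lower bound for the energy of a periodic lattice function by the continuous variational
formula, with explicit error terms. -/
lemma rhoContinuous_mul_le_periodic {p q a α K : ℝ} (hp : 1 < p) (hpq : p.HolderConjugate q)
    (ha : 0 < a) (hα : 0 < α) (hK : 0 < K) {L w n : ℕ} (hL : 0 < L) (hw : K * α ≤ w)
    (hn : n + 2 * w ≤ L) {h : (Fin d → ℤ) → ℝ} (hh : IsPeriodic L h)
    (h1 : periodNorm (2 * p) L h = 1) {F E : ℝ}
    (hF : F = a * (α ^ 2)⁻¹ * periodNorm 2 L h ^ 2 +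
      1 / 2 * periodNorm 2 L (discreteGradient h) ^ 2)
    (hE : √(2 * (cutoffLoss d a K * F)) ≤ E) (hPE : d * E < (((n : ℝ) / L) ^ d) ^ (1 / (2 * p))) :
    rhoContinuous d p a * ENNReal.ofReal (((((n : ℝ) / L) ^ d) ^ (1 / (2 * p)) - d * E) ^ 2) ≤
      ENNReal.ofReal (cutoffLoss d a K * (α ^ (2 - d / q) * F)) := by
  have hp2 : 0 < 2 * p := by linarith
  have hw0 : 0 < w := by
    have : (0 : ℝ) < w := lt_of_lt_of_le (by positivity) hw
    exact_mod_cast this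
  set P : ℝ := (((n : ℝ) / L) ^ d) ^ (1 / (2 * p)) with hP
  set b : ℝ := ((α⁻¹) ^ d) ^ (1 / (2 * p)) with hb
  have hb0 : 0 < b := by positivity
  obtain ⟨k, hk, hk2, hkD, hkp⟩ := hh.exists_cutoff hL hw0 hn hp2 (one_div_pos.2 hK)
  rw [sum_eq_one_of_periodNorm_eq_one hp2 h1, mul_one] at hkp
  have hXe : periodNorm 2 L h ^ 2 = ∑ x : Fin d → Fin L, h (cellPoint x) ^ 2 := by
    simp_rw [periodNorm_two_sq, Real.norm_eq_abs, sq_abs]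
  have hYe : periodNorm 2 L (discreteGradient h) ^ 2 =
      ∑ i, ∑ x : Fin d → Fin L, forwardDiff i h (cellPoint x) ^ 2 := by
    simp_rw [periodNorm_two_sq, norm_discreteGradient_sq]
    exact Finset.sum_comm
  rw [← hXe] at hk2
  rw [← hXe, ← hYe] at hkD
  set X := periodNorm 2 L h ^ 2
  set Y := periodNorm 2 L (discreteGradient h) ^ 2
  have hX0 : 0 ≤ X := sq_nonneg _
  have hY0 : 0 ≤ Y := sq_nonneg _
  set Z := (1 + 1 / K) * Y + (1 + 1 / (1 / K)) * (1 / w) ^ 2 * d * X with hZ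
  have hZ0 : 0 ≤ Z := by positivity
  have hlam : 0 ≤ a * (α ^ 2)⁻¹ * X := by positivity
  have hen := cutoff_energy_le (d := d) ha hα hK hw hX0 hY0
  rw [← hF, ← hZ] at hen
  have hZE : √Z ≤ E := (Real.sqrt_le_sqrt (by linarith)).trans hE
  have hdZ : d * √Z ≤ d * E := by gcongr
  have hPk : ENNReal.ofReal P ≤ (∑' x, ‖k x‖ₑ ^ (2 * p)) ^ (1 / (2 * p)) := by
    rw [hP, ← ENNReal.ofReal_rpow_of_nonneg (by positivity) (by positivity)]
    gcongr
  have key := rhoContinuous_mul_le_discrete hp ha.le hα hk hX0 hZ0 hk2 hkD hPk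
    (hdZ.trans_lt hPE)
  rw [← hb] at key
  have hscale := rpow_scaling hpq hα d
  rw [← hb] at hscale
  -- Both sides carry the squared normalisation `b ^ 2`, which is restored here so that `key`
  -- applies.
  have hb2 : ENNReal.ofReal (b ^ 2) ≠ 0 := by
    rw [Ne, ENNReal.ofReal_eq_zero, not_le]
    positivity
  rw [← ENNReal.mul_le_mul_iff_right hb2 ENNReal.ofReal_ne_top]
  calc ENNReal.ofReal (b ^ 2) * (rhoContinuous d p a * ENNReal.ofReal ((P - d * E) ^ 2))
      = rhoContinuous d p a * ENNReal.ofReal ((b * (P - d * E)) ^ 2) := by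
        rw [mul_pow, ENNReal.ofReal_mul (by positivity)]
        ring
    _ ≤ rhoContinuous d p a * ENNReal.ofReal ((b * (P - d * √Z)) ^ 2) := by
        have : 0 ≤ P - d * E := by linarith
        gcongr
    _ ≤ _ := key
    _ ≤ ENNReal.ofReal (b ^ 2 * (cutoffLoss d a K * (α ^ (2 - d / q) * F))) := by
        refine ENNReal.ofReal_le_ofReal ?_
        calc a * ((α⁻¹) ^ d * X) + 1 / 2 * (α ^ 2 * (α⁻¹) ^ d * Z)
            = α ^ 2 * (α⁻¹) ^ d * (a * (α ^ 2)⁻¹ * X + 1 / 2 * Z) := by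
              have : α ^ 2 ≠ 0 := by positivity
              field_simp
          _ ≤ α ^ 2 * (α⁻¹) ^ d * (cutoffLoss d a K * F) := by gcongr
          _ = _ := by
              rw [hscale]
              ring
    _ = _ := ENNReal.ofReal_mul (by positivity)

/-- The previous bound in terms of the discrete variational formula. -/
lemma le_mul_rhoDiscrete {p q a α K : ℝ} (hp : 1 < p) (hpq : p.HolderConjugate q)
    (ha : 0 < a) (hα : 0 < α) (hK : 0 < K) {L w n : ℕ} (hL : 0 < L) (hw : K * α ≤ w)
    (hn : n + 2 * w ≤ L) {M M' E : ℝ} (hM' : ENNReal.ofReal M' ≤ rhoContinuous d p a)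
    (hE : E = √(2 * (cutoffLoss d a K * (M * α ^ (d / q - 2)))))
    (hPE : d * E < (((n : ℝ) / L) ^ d) ^ (1 / (2 * p)))
    (hMM : cutoffLoss d a K * M <
      M' * ((((n : ℝ) / L) ^ d) ^ (1 / (2 * p)) - d * E) ^ 2) :
    ENNReal.ofReal M ≤
      ENNReal.ofReal (α ^ (2 - d / q)) * rhoDiscrete d p (a * (α ^ 2)⁻¹) L := by
  have hB := cutoffLoss_pos (d := d) ha hK
  have hαp : 0 < α ^ (2 - d / q) := by positivity
  simp only [rhoDiscrete, ENNReal.mul_iInf_of_ne (ENNReal.ofReal_pos.2 hαp).ne'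
    ENNReal.ofReal_ne_top]
  refine le_iInf fun h => le_iInf fun hh => le_iInf fun h1 => ?_
  set F := a * (α ^ 2)⁻¹ * periodNorm 2 L h ^ 2 +
      1 / 2 * periodNorm 2 L (discreteGradient h) ^ 2 with hF
  rw [← ENNReal.ofReal_mul hαp.le]
  refine ENNReal.ofReal_le_ofReal ?_
  by_contra! hlt
  have hFM : F ≤ M * α ^ (d / q - 2) := by
    have h2 : α ^ (2 - d / q) * α ^ (d / q - 2) = 1 := by
      rw [← Real.rpow_add hα, sub_add_sub_cancel, sub_self, Real.rpow_zero]
    have h3 : 0 < α ^ (d / q - 2) := by positivity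
    calc F = α ^ (2 - d / q) * F * α ^ (d / q - 2) := by linear_combination (-F) * h2
      _ ≤ _ := by gcongr
  have hE' : √(2 * (cutoffLoss d a K * F)) ≤ E := by
    rw [hE]
    gcongr
  have key := rhoContinuous_mul_le_periodic hp hpq ha hα hK hL hw hn hh h1 hF hE' hPE
  have h4 : ENNReal.ofReal (M' * ((((n : ℝ) / L) ^ d) ^ (1 / (2 * p)) - d * E) ^ 2) ≤
      ENNReal.ofReal (cutoffLoss d a K * (α ^ (2 - d / q) * F)) := by
    refine le_trans ?_ key
    rw [ENNReal.ofReal_mul' (by positivity)]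
    gcongr
  have h5 : 0 ≤ cutoffLoss d a K * (α ^ (2 - d / q) * F) := by positivity
  have h6 := (ENNReal.ofReal_le_ofReal_iff h5).1 h4
  have h7 : cutoffLoss d a K * (α ^ (2 - d / q) * F) ≤ cutoffLoss d a K * M := by gcongr
  linarith

/-! ### Passing to the limit -/

/-- In the variable `K⁻¹` both sides are continuous at `0`, with values `M` and `M'`. -/
lemma eventually_cutoffLoss_mul_lt {a p M M' : ℝ} (hp : 0 < p) (hMM : M < M') :
    ∀ᶠ K : ℝ in atTop, cutoffLoss d a K * M < M' * (((1 - 2 / K) ^ d) ^ (1 / (2 * p))) ^ 2 := by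
  have h1 : Tendsto (fun x : ℝ => (1 + x + (x ^ 2 + x) * (d / (2 * a))) * M) (𝓝 0) (𝓝 M) := by
    have : Continuous fun x : ℝ => (1 + x + (x ^ 2 + x) * (d / (2 * a))) * M := by fun_prop
    simpa using this.tendsto 0
  have h2 : Tendsto (fun x : ℝ => M' * (((1 - 2 * x) ^ d) ^ (1 / (2 * p))) ^ 2) (𝓝 0) (𝓝 M') := by
    have : Continuous fun x : ℝ => M' * (((1 - 2 * x) ^ d) ^ (1 / (2 * p))) ^ 2 := by
      refine continuous_const.mul (Continuous.pow (Continuous.rpow_const (by fun_prop) ?_) 2)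
      exact fun _ => Or.inr (by positivity)
    simpa using this.tendsto 0
  have h3 := tendsto_inv_atTop_zero.eventually (h1.eventually_lt h2 hMM)
  filter_upwards [h3, eventually_gt_atTop (0 : ℝ)] with K hK hK0
  have h4 : cutoffLoss d a K = 1 + K⁻¹ + (K⁻¹ ^ 2 + K⁻¹) * (d / (2 * a)) := by
    -- At `a = 0` division by zero makes the last term vanish on both sides.
    rcases eq_or_ne a 0 with rfl | ha
    · simp [cutoffLoss]
    · unfold cutoffLoss
      field_simp
  rw [h4, div_eq_mul_inv 2 K]
  exact hK

/-- For fixed `K`, take `w = ⌈K * α t⌉₊` and `n = L t - 2 * w`. Then `n / L t → 1 - 2 / K` while the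
interpolation loss vanishes, so the strict inequality `hMM` between the limits persists for large
`t`. -/
lemma eventually_le_mul_rhoDiscrete {p q a K M M' : ℝ} (hp : 1 < p) (hpq : p.HolderConjugate q)
    (hsub : p * ((d : ℝ) - 2) < d) (ha : 0 < a) (hK : 2 < K) {α : ℝ → ℝ}
    (hα : Tendsto α atTop atTop) {L : ℝ → ℕ} (hL : ∀ᶠ t in atTop, |(L t : ℝ) - K ^ 2 * α t| ≤ 1)
    (hM' : ENNReal.ofReal M' ≤ rhoContinuous d p a)
    (hMM : cutoffLoss d a K * M < M' * (((1 - 2 / K) ^ d) ^ (1 / (2 * p))) ^ 2) :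
    ∀ᶠ t in atTop, ENNReal.ofReal M ≤
      ENNReal.ofReal (α t ^ (2 - d / q)) * rhoDiscrete d p (a * (α t ^ 2)⁻¹) (L t) := by
  have hK0 : 0 < K := by linarith
  have hαpos : ∀ᶠ t in atTop, 0 < α t := hα.eventually_gt_atTop 0
  let w : ℝ → ℕ := fun t => ⌈K * α t⌉₊
  have hw : Tendsto (fun t => (w t : ℝ) / α t) atTop (𝓝 K) :=
    (tendsto_nat_ceil_mul_div_atTop hK0.le).comp hα
  have hLα : Tendsto (fun t => (L t : ℝ) / α t) atTop (𝓝 (K ^ 2)) := by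
    rw [tendsto_iff_dist_tendsto_zero]
    refine squeeze_zero' (Eventually.of_forall fun _ => dist_nonneg) ?_
      (tendsto_inv_atTop_zero.comp hα)
    filter_upwards [hL, hαpos] with t ht ht0
    have h1 : (L t : ℝ) / α t - K ^ 2 = (L t - K ^ 2 * α t) / α t := by field_simp
    rw [Real.dist_eq, h1, abs_div, abs_of_pos ht0, Function.comp_apply, ← one_div]
    gcongr
  have hdiff : Tendsto (fun t => (L t : ℝ) / α t - 2 * (w t / α t)) atTop
      (𝓝 (K ^ 2 - 2 * K)) := hLα.sub (hw.const_mul 2)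
  have hpos : 0 < K ^ 2 - 2 * K := by nlinarith
  have hwL : ∀ᶠ t in atTop, 2 * w t < L t := by
    filter_upwards [hdiff.eventually_const_lt hpos, hαpos] with t ht ht0
    have h1 : (L t : ℝ) / α t - 2 * (w t / α t) = (L t - 2 * w t) / α t := by ring
    rw [h1, div_pos_iff_of_pos_right ht0] at ht
    have : (2 * w t : ℝ) < L t := by linarith
    exact_mod_cast this
  -- The subtraction is truncated in `ℕ`; `hwL` makes it genuine for large `t`.
  have hratio : Tendsto (fun t => ((L t - 2 * w t : ℕ) : ℝ) / L t) atTop (𝓝 (1 - 2 / K)) := by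
    have h1 : (K ^ 2 - 2 * K) / K ^ 2 = 1 - 2 / K := by field_simp
    rw [← h1]
    refine (hdiff.div hLα (by positivity)).congr' ?_
    filter_upwards [hwL, hαpos] with t ht ht0
    have : (0 : ℝ) < L t := by
      have : 0 < L t := by omega
      exact_mod_cast this
    rw [Nat.cast_sub ht.le]
    push_cast
    simp only [Pi.div_apply]
    field_simp
  -- Subcriticality of `p` enters here, and it drives the interpolation loss `E` to zero.
  have hexp : (d : ℝ) / q - 2 < 0 := by
    have hp0 : 0 < p := by linarith
    have hinv := hpq.inv_add_inv_eq_one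
    have h1 : (d : ℝ) / q = d - d / p := by
      rw [div_eq_mul_inv, div_eq_mul_inv]
      linear_combination (d : ℝ) * hinv
    have h2 : (d : ℝ) - 2 < d / p := by
      rw [lt_div_iff₀ hp0]
      linarith
    linarith
  let E : ℝ → ℝ := fun t => √(2 * (cutoffLoss d a K * (M * α t ^ (d / q - 2))))
  have hE : Tendsto E atTop (𝓝 0) := by
    have h1 : Tendsto (fun t => α t ^ (d / q - 2)) atTop (𝓝 0) := by
      have h2 := (tendsto_rpow_neg_atTop (y := 2 - d / q) (by linarith)).comp hα
      refine h2.congr fun t => ?_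
      rw [Function.comp_apply, neg_sub]
    have h3 := (((h1.const_mul M).const_mul (cutoffLoss d a K)).const_mul 2).sqrt
    simpa only [mul_zero, Real.sqrt_zero] using h3
  have hP : Tendsto (fun t => ((((L t - 2 * w t : ℕ) : ℝ) / L t) ^ d) ^ (1 / (2 * p)) - d * E t)
      atTop (𝓝 (((1 - 2 / K) ^ d) ^ (1 / (2 * p)))) := by
    have h1 := ((hratio.pow d).rpow_const (p := 1 / (2 * p)) (Or.inr (by positivity))).sub
      (hE.const_mul (d : ℝ))
    simpa using h1
  have hκ : 0 < 1 - 2 / K := by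
    rw [sub_pos, div_lt_one hK0]
    exact hK
  have hPpos := hP.eventually_const_lt (show 0 < ((1 - 2 / K) ^ d) ^ (1 / (2 * p)) by positivity)
  have hPM := ((hP.pow 2).const_mul M').eventually_const_lt hMM
  filter_upwards [hαpos, hwL, hPpos, hPM] with t ht0 ht1 ht2 ht3
  exact le_mul_rhoDiscrete hp hpq ha ht0 hK0 (by omega) (w := w t) (Nat.le_ceil _) (by omega) hM' rfl
    (by linarith) ht3

end

/-! ### The iterated lower limit -/

theorem proposition1p3 (d : ℕ) (hd : 1 ≤ d) (p q : ℝ) (hp : 1 < p) (hpq : p.HolderConjugate q)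
    (hsub : p * ((d : ℝ) - 2) < d) (a : ℝ) (ha : 0 < a)
    (r α lam : ℝ → ℝ) (hr_pos : ∀ᶠ t in atTop, 0 < r t) (hr : Tendsto r atTop (𝓝 0))
    (hα : ∀ t, α t = r t ^ (-(q / d))) (hlam : ∀ t, lam t = a * (α t ^ 2)⁻¹)
    (L : ℝ → ℝ → ℕ)
    (hL : ∀ R > 0, ∀ᶠ t in atTop, |(L R t : ℝ) - R * α t| ≤ 1) :
    rhoContinuous d p a ≤
      liminf (fun R : ℝ =>
        liminf (fun t : ℝ =>
          ENNReal.ofReal (r t ^ (1 - 2 * q / d)) * rhoDiscrete d p (lam t) (L R t)) atTop) atTop := by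
  have hd0 : (0 : ℝ) < d := by exact_mod_cast hd
  have hq : 0 < q := hpq.symm.pos
  have hα_top : Tendsto α atTop atTop := by
    have h1 : Tendsto r atTop (𝓝[>] 0) := tendsto_nhdsWithin_iff.2 ⟨hr, hr_pos⟩
    have h2 := (tendsto_rpow_atTop (show 0 < q / d by positivity)).comp
      (tendsto_inv_nhdsGT_zero.comp h1)
    refine h2.congr' ?_
    filter_upwards [hr_pos] with t ht
    simp only [Function.comp_apply]
    rw [hα, Real.inv_rpow ht.le, Real.rpow_neg ht.le]
  have hscale : ∀ᶠ t in atTop, r t ^ (1 - 2 * q / d) = α t ^ (2 - d / q) := by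
    filter_upwards [hr_pos] with t ht
    rw [hα, ← Real.rpow_mul ht.le]
    congr 1
    field_simp
    ring
  refine le_of_forall_lt fun c hc => ?_
  -- Two intermediate values: `c'` is the bound to be proved, and the gap up to `c''` absorbs the
  -- losses. Both are finite even if `rhoContinuous d p a` is not known to be.
  obtain ⟨c', hcc', hc'⟩ := exists_between hc
  obtain ⟨c'', hcc'', hc''⟩ := exists_between hc'
  refine hcc'.trans_le ?_
  have htop' : c' ≠ ⊤ := (hc'.trans_le le_top).ne
  have htop'' : c'' ≠ ⊤ := (hc''.trans_le le_top).ne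
  have hlt : c'.toReal < c''.toReal := (ENNReal.toReal_lt_toReal htop' htop'').2 hcc''
  have hM' : ENNReal.ofReal c''.toReal ≤ rhoContinuous d p a := by
    rw [ENNReal.ofReal_toReal htop'']
    exact hc''.le
  have hK := (eventually_cutoffLoss_mul_lt (d := d) (a := a) (by linarith : 0 < p) hlt).and
    (eventually_gt_atTop (2 : ℝ))
  refine le_liminf_of_le (by isBoundedDefault) ?_
  -- The choice `K = √R` makes the boundary layer wide in absolute terms but negligible relative to
  -- the side `R`.
  filter_upwards [Real.tendsto_sqrt_atTop.eventually hK, eventually_gt_atTop (0 : ℝ)]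
    with R hR hR0
  refine le_liminf_of_le (by isBoundedDefault) ?_
  have hL' : ∀ᶠ t in atTop, |(L R t : ℝ) - √R ^ 2 * α t| ≤ 1 := by
    rw [Real.sq_sqrt hR0.le]
    exact hL R hR0
  filter_upwards [eventually_le_mul_rhoDiscrete hp hpq hsub ha hR.2 hα_top hL' hM' hR.1, hscale]
    with t ht ht'
  rw [ht', hlam]
  rwa [ENNReal.ofReal_toReal htop'] at ht
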